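/- **Setting.** Fix $T>0$, $s_0>0$, $\mu\in\mathbb R$. A *fractional Brownian motion* (fBm) $B=(B_t)_{t\in[0,T]}$ with Hurst index $H\in(0,1)$ is a centered Gaussian process with $B_0=0$ and $\mathrm{Cov}[B_t,B_s]=\frac12\left(t^{2H}+s^{2H}-|t-s|^{2H}\right)$; for $H=1/2$ it is called a Brownian motion (Bm) $W$. Consider the following discounted stock-price models $S=(S_t)_{t\in[0,T]}$ (with continuous paths): 1. Black–Scholes (BS): $S_t=s_0e^{\mu t+\sigma W_t-\frac12\sigma^2t}$, with $W$ a Bm and $\sigma>0$; 2. fractional Black–Scholes (fBS): $S_t=s_0e^{\mu t+\nu B_t}$, with $B$ an fBm of index $H\in(0,1)$, $H\neq\frac12$, and $\nu>0$; 3. mixed fractional Black–Scholes (mfBS): $S_t=s_0e^{\mu t+\sigma W_t-\frac12\sigma^2t+\nu B_t}$, with $W$ a Bm and $B$ an fBm of index $H\in(0,1)$, $H\ne\frac12$, independent of $W$, and $\sigma,\nu>0$. For real $a\le b$ and $x>0$ let $C_x^+([a,b])$ be the space of positive continuous functions on $[a,b]$ with value $x$ at $a$, with the supremum distance. We work on $\Omega=C^+_{s_0}([0,T])$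 with co-ordinate process $S_t(\omega)=\omega_t$, with $\mathbb P$ the law of one of the models, and with $(\mathcal F_t)_{t\in[0,T]}$ the filtration generated by $S$, augmented to satisfy the usual conditions (completeness and right-continuity). **Delay property.** A non-decreasing sequence of stopping times $0\le\tau_0\le\dots\le\tau_n\le T$ has the delay property if for every $k<n$ there are an $\mathcal F_{\tau_k}$-measurable random set $U_k$, which is an open subset of $C^+_{S_{\tau_k}}([\tau_k,T])$ and is almost surely non-empty, and an $\mathcal F_{\tau_k}$-measurable, a.s. positive random variable $\varepsilon_k$ such that $\tau_{k+1}-\tau_k\ge\varepsilon_k$ almost surely on the event $\{(S_t)_{t\in[\tau_k,T]}\in U_k\}\cap\{\tau_{k+1}>\tau_k\}$. (Measurability of $U_k$ means: the set of pairs $(\omega,\omega')\in\Omega\times\Omega$ with $\omega'|_{[\tau_k(\omega),T]}\in U_k(\omega)$ belongs to the product of $\mathcal F_{\tau_k}$ and the $\sigma$-algebra on $\Omega$ generated by the co-ordinates.) **Delay-simple strategies.** A portfolio is a pair of adapted processes $\mathbf\Phi=(\Phi^0_t,\Phi_t)_{t\in[0,T]}$, with value $V_t(\mathbf\Phi)=\Phi^0_t+\Phi_tS_t$.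 It is delay-simple if there are stopping times $\tau_0\le\dots\le\tau_n$ with the delay property such that $$\Phi_t=\sum_{k=0}^{n-1}\phi_{\tau_k}\mathbf 1_{(\tau_k,\tau_{k+1}]}(t),\qquad \phi_{\tau_k}\ \ \mathcal F_{\tau_k}\text{-measurable},$$ $\Phi^0$ is likewise piecewise constant, equal to an $\mathcal F_0$-measurable variable on $[0,\tau_0]$ and to $\mathcal F_{\tau_k}$-measurable variables on $(\tau_k,\tau_{k+1}]$ for $0\le k\le n-1$ and, for $k=n$, on $(\tau_n,T]$, and $\mathbf\Phi$ is self-financing: almost surely, for every $k\le n$, with $\tau_{n+1}:=T$, $$V_{\tau_{k+1}}(\mathbf\Phi)-V_{\tau_k}(\mathbf\Phi)=\Phi_{\tau_{k+1}}(S_{\tau_{k+1}}-S_{\tau_k}).$$ A portfolio is an *arbitrage* if $V_0(\mathbf\Phi)=0$ a.s., $V_T(\mathbf\Phi)\ge0$ a.s. and $\mathbb P[V_T(\mathbf\Phi)>0]>0$. **Theorem.** In each of the models BS, fBS and mfBS no delay-simple strategy is an arbitrage. -/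

import Mathlib

open MeasureTheory ProbabilityTheory Set Filter
open scoped Topology

noncomputable section

namespace DelaySimple

/-! ### Path spaces -/

/-- The space `C⁺_x([a, b])` of positive continuous functions on `[a, b]` which start from `x` at
time `a`. -/
def PosPath (a b x : ℝ) : Type :=
  {f : C(Set.Icc a b, ℝ) // (∀ t, 0 < f t) ∧ ∀ t : Set.Icc a b, (t : ℝ) = a → f t = x}

instance (a b x : ℝ) : CoeFun (PosPath a b x) (fun _ => Set.Icc a b → ℝ) where
  coe f := f.1

/-- The supremum distance; it induces the topology of uniform convergence. -/
instance (a b x : ℝ) : MetricSpace (PosPath a b x) :=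
  inferInstanceAs (MetricSpace
    {f : C(Set.Icc a b, ℝ) // (∀ t, 0 < f t) ∧ ∀ t : Set.Icc a b, (t : ℝ) = a → f t = x})

/-- The σ-algebra generated by the co-ordinate maps. -/
instance PosPath.cylinderSigma (a b x : ℝ) : MeasurableSpace (PosPath a b x) :=
  ⨆ t : Set.Icc a b, MeasurableSpace.comap (fun f : PosPath a b x => f t) inferInstance

/-- The restriction of a path on `[a, b]` to `[c, b]`, a path which starts from `y = f c`. -/
def PosPath.tail {a b x : ℝ} (f : PosPath a b x) (c : Set.Icc a b) (y : ℝ) (hy : f c = y) :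
    PosPath c b y :=
  ⟨⟨fun t => f ⟨t, c.2.1.trans t.2.1, t.2.2⟩,
      f.1.continuous.comp (Continuous.subtype_mk continuous_subtype_val _)⟩,
    fun _ => f.2.1 _, fun t ht => by
      have : (⟨t, c.2.1.trans t.2.1, t.2.2⟩ : Set.Icc a b) = c := Subtype.ext ht
      simpa [this] using hy⟩

/-! ### The canonical stochastic basis -/

section Basis

variable {T s₀ : ℝ}

/-- The completion under `P` of the σ-algebra of the path space. -/
abbrev completedSigma (P : Measure (PosPath 0 T s₀)) : MeasurableSpace (PosPath 0 T s₀) :=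
  inferInstanceAs (MeasurableSpace (NullMeasurableSpace (PosPath 0 T s₀) P))

/-- The filtration generated by the co-ordinate process and the `P`-null sets. -/
def completedFiltration (P : Measure (PosPath 0 T s₀)) :
    Filtration (Set.Icc (0 : ℝ) T) (completedSigma P) where
  seq t := (⨆ s : Set.Icc (0 : ℝ) T, ⨆ _ : s ≤ t,
      MeasurableSpace.comap (fun ω : PosPath 0 T s₀ => ω s) inferInstance) ⊔
    MeasurableSpace.generateFrom {N | P N = 0}
  mono' _ _ hst := by
    refine sup_le_sup_right (iSup₂_le fun s hs => ?_) _
    exact le_iSup₂_of_le (f := fun (s : Set.Icc (0 : ℝ) T) (_ : s ≤ _) =>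
      MeasurableSpace.comap (fun ω : PosPath 0 T s₀ => ω s) inferInstance) s (hs.trans hst) le_rfl
  le' t := by
    refine sup_le (iSup₂_le fun s _ => ?_) (MeasurableSpace.generateFrom_le ?_)
    · intro A hA
      have h1 : MeasurableSet A := (le_iSup (fun t : Set.Icc (0 : ℝ) T =>
        MeasurableSpace.comap (fun f : PosPath 0 T s₀ => f t) inferInstance) s) A hA
      exact h1.nullMeasurableSet
    · intro N hN
      exact NullMeasurableSet.of_null hN

/-- The filtration generated by the stock price (the co-ordinate process), augmented to satisfy
the usual conditions of completeness and right-continuity. -/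
def usualFiltration (P : Measure (PosPath 0 T s₀)) :
    Filtration (Set.Icc (0 : ℝ) T) (completedSigma P) :=
  (completedFiltration P).rightCont

/-- A non-decreasing sequence `0 ≤ τ₀ ≤ ⋯ ≤ τₙ ≤ T` of stopping times. -/
structure StoppingSeq (P : Measure (PosPath 0 T s₀)) (n : ℕ) where
  time : Fin (n + 1) → PosPath 0 T s₀ → Set.Icc (0 : ℝ) T
  isStoppingTime : ∀ k,
    IsStoppingTime (usualFiltration P) (fun ω => (time k ω : WithTop (Set.Icc (0 : ℝ) T)))
  monotone : ∀ ω, Monotone fun k => time k ω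

/-- The σ-algebra of the events prior to `τₖ`. -/
abbrev StoppingSeq.sigma {P : Measure (PosPath 0 T s₀)} {n : ℕ} (τ : StoppingSeq P n)
    (k : Fin (n + 1)) : MeasurableSpace (PosPath 0 T s₀) :=
  (τ.isStoppingTime k).measurableSpace

/-- The delay property. For each `k < n` there are a random non-empty open set `U` of positive
continuous paths on `[τₖ, T]` starting from `S_{τₖ}`, and a random variable `ε > 0`, both
measurable with respect to the σ-algebra of `τₖ`, such that `τₖ₊₁ - τₖ ≥ ε` on the event that
`τₖ₊₁ > τₖ` and the price path on `[τₖ, T]` belongs to `U`. Measurability of the random set `U`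
is measurability of its graph, where paths on `[τₖ, T]` are given as restrictions of paths on
`[0, T]`. -/
def StoppingSeq.HasDelay {P : Measure (PosPath 0 T s₀)} {n : ℕ} (τ : StoppingSeq P n) : Prop :=
  ∀ k : Fin n,
    ∃ (U : (ω : PosPath 0 T s₀) →
        Set (PosPath (τ.time k.castSucc ω) T (ω (τ.time k.castSucc ω))))
      (ε : PosPath 0 T s₀ → ℝ),
      (∀ ω, IsOpen (U ω)) ∧
      (∀ᵐ ω ∂P, (U ω).Nonempty) ∧
      MeasurableSet[(τ.sigma k.castSucc).prod (PosPath.cylinderSigma 0 T s₀)]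
        {p : PosPath 0 T s₀ × PosPath 0 T s₀ |
          ∃ h : p.2 (τ.time k.castSucc p.1) = p.1 (τ.time k.castSucc p.1),
            p.2.tail (τ.time k.castSucc p.1) _ h ∈ U p.1} ∧
      Measurable[τ.sigma k.castSucc] ε ∧
      (∀ᵐ ω ∂P, 0 < ε ω) ∧
      ∀ᵐ ω ∂P, ω.tail (τ.time k.castSucc ω) _ rfl ∈ U ω →
        τ.time k.castSucc ω < τ.time k.succ ω →
        ε ω ≤ (τ.time k.succ ω : ℝ) - (τ.time k.castSucc ω : ℝ)

/-! ### Portfolios -/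

/-- A portfolio: the adapted numbers of bonds and of shares. -/
structure Portfolio (P : Measure (PosPath 0 T s₀)) where
  bond : Set.Icc (0 : ℝ) T → PosPath 0 T s₀ → ℝ
  stock : Set.Icc (0 : ℝ) T → PosPath 0 T s₀ → ℝ
  bond_adapted : Adapted (usualFiltration P) bond
  stock_adapted : Adapted (usualFiltration P) stock

/-- The discounted value of a portfolio. -/
def Portfolio.value {P : Measure (PosPath 0 T s₀)} (Φ : Portfolio P) (t : Set.Icc (0 : ℝ) T)
    (ω : PosPath 0 T s₀) : ℝ :=
  Φ.bond t ω + Φ.stock t ω * ω t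

/-- The time `0`. -/
def startTime (hT : 0 < T) : Set.Icc (0 : ℝ) T := ⟨0, le_rfl, hT.le⟩

/-- The time `T`. -/
def endTime (hT : 0 < T) : Set.Icc (0 : ℝ) T := ⟨T, hT.le, le_rfl⟩

/-- A portfolio is an arbitrage if it costs nothing, its terminal value is almost surely
non-negative, and its terminal value is positive with positive probability. -/
def Portfolio.IsArbitrage {P : Measure (PosPath 0 T s₀)} (hT : 0 < T) (Φ : Portfolio P) : Prop :=
  (∀ᵐ ω ∂P, Φ.value (startTime hT) ω = 0) ∧
  (∀ᵐ ω ∂P, 0 ≤ Φ.value (endTime hT) ω) ∧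
  0 < P {ω | 0 < Φ.value (endTime hT) ω}

/-- The portfolio is simple with readjustment times `τ`: the stock position is
`∑_{k < n} φₖ 1_{(τₖ, τₖ₊₁]}` with `φₖ` measurable with respect to the σ-algebra of `τₖ`, and the
bond position is likewise constant on each `(τₖ, τₖ₊₁]`, on `[0, τ₀]` and on `(τₙ, T]`, where no
shares are held. -/
def Portfolio.IsSimpleAlong {P : Measure (PosPath 0 T s₀)} (hT : 0 < T) (Φ : Portfolio P)
    {n : ℕ} (τ : StoppingSeq P n) : Prop :=
  (∃ φ : Fin n → PosPath 0 T s₀ → ℝ,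
    (∀ k, Measurable[τ.sigma k.castSucc] (φ k)) ∧
    ∀ t ω, Φ.stock t ω =
      ∑ k : Fin n, (Set.Ioc (τ.time k.castSucc ω) (τ.time k.succ ω)).indicator
        (fun _ => φ k ω) t) ∧
  (∃ (ψ₀ : PosPath 0 T s₀ → ℝ) (ψ : Fin (n + 1) → PosPath 0 T s₀ → ℝ),
    Measurable[usualFiltration P (startTime hT)] ψ₀ ∧
    (∀ k, Measurable[τ.sigma k] (ψ k)) ∧
    ∀ t ω, Φ.bond t ω =
      (Set.Iic (τ.time 0 ω)).indicator (fun _ => ψ₀ ω) t +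
      ∑ k : Fin n, (Set.Ioc (τ.time k.castSucc ω) (τ.time k.succ ω)).indicator
        (fun _ => ψ k.castSucc ω) t +
      (Set.Ioi (τ.time (Fin.last n) ω)).indicator (fun _ => ψ (Fin.last n) ω) t)

/-- The portfolio is self-financing over the intervals between its readjustment times `τ`, and
over the last interval, from `τₙ` to `T`. -/
def Portfolio.IsSelfFinancingAlong {P : Measure (PosPath 0 T s₀)} (hT : 0 < T) (Φ : Portfolio P)
    {n : ℕ} (τ : StoppingSeq P n) : Prop :=
  (∀ k : Fin n, ∀ᵐ ω ∂P,
    Φ.value (τ.time k.succ ω) ω - Φ.value (τ.time k.castSucc ω) ω =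
      Φ.stock (τ.time k.succ ω) ω * (ω (τ.time k.succ ω) - ω (τ.time k.castSucc ω))) ∧
  ∀ᵐ ω ∂P,
    Φ.value (endTime hT) ω - Φ.value (τ.time (Fin.last n) ω) ω =
      Φ.stock (endTime hT) ω * (ω (endTime hT) - ω (τ.time (Fin.last n) ω))

/-- The class of (self-financing) delay-simple strategies. -/
def delaySimple (hT : 0 < T) (P : Measure (PosPath 0 T s₀)) : Set (Portfolio P) :=
  {Φ | ∃ (n : ℕ) (τ : StoppingSeq P n),
    τ.HasDelay ∧ Φ.IsSimpleAlong hT τ ∧ Φ.IsSelfFinancingAlong hT τ}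

/-- There is no arbitrage in the class `𝒜` of portfolios. -/
def NoArbitrageIn (hT : 0 < T) {P : Measure (PosPath 0 T s₀)} (𝒜 : Set (Portfolio P)) : Prop :=
  ∀ Φ ∈ 𝒜, ¬ Φ.IsArbitrage hT

end Basis

/-! ### The driving processes and the models -/

section Models

variable {E : Type*} [MeasurableSpace E]

/-- Fractional Brownian motion on `[0, T]` with Hurst index `H`: a centered Gaussian process which
starts from zero and has covariance `(t ^ (2H) + s ^ (2H) - |t - s| ^ (2H)) / 2`. -/
structure IsFBm {T : ℝ} (H : ℝ) (B : Set.Icc (0 : ℝ) T → E → ℝ) (Q : Measure E) : Prop where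
  gaussian : IsGaussianProcess B Q
  zero : ∀ t : Set.Icc (0 : ℝ) T, (t : ℝ) = 0 → ∀ᵐ e ∂Q, B t e = 0
  centered : ∀ t : Set.Icc (0 : ℝ) T, ∫ e, B t e ∂Q = 0
  covariance : ∀ t s : Set.Icc (0 : ℝ) T, cov[B t, B s; Q] =
    ((t : ℝ) ^ (2 * H) + (s : ℝ) ^ (2 * H) - |(t : ℝ) - s| ^ (2 * H)) / 2

/-- Brownian motion on `[0, T]`, the fractional Brownian motion with Hurst index `1 / 2`. -/
def IsBm {T : ℝ} (W : Set.Icc (0 : ℝ) T → E → ℝ) (Q : Measure E) : Prop :=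
  IsFBm (1 / 2) W Q

/-- `P` is the law, on the space of positive continuous paths from `s₀`, of the (continuous
version of the) process `S`. -/
def IsPathLaw {T s₀ : ℝ} (S : Set.Icc (0 : ℝ) T → E → ℝ) (Q : Measure E)
    (P : Measure (PosPath 0 T s₀)) : Prop :=
  ∃ X : E → PosPath 0 T s₀, HasLaw X P Q ∧ ∀ t, ∀ᵐ e ∂Q, X e t = S t e

end Models

end DelaySimple

end

/-! The proof works path by path, off null sets, and uses one property of the price law,
`HasShifts`. There is a countable family of functions `g` such that replacing `ω` by `ω exp(g)`
pulls null sets back to null sets. For `a < b`, every continuous function vanishing up to `b` is a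
uniform limit of members of the family vanishing up to `a`.

Shifts come from a Cameron–Martin argument (`measure_add_mem_eq_zero`): a centered Gaussian law is
quasi-invariant under translation by its reproducing kernel space. By the spectral representation of
fBm, that space contains every Schwartz function vanishing at the origin (`exists_norm_sq_sum_le`),
for every `H` in `(0, 1)`. An independent summand only enlarges the covariance, so the mixed model
inherits the shifts of its Brownian part.

On the trading side, what is known at `τₖ` depends, up to null sets, only on the path up to any time
strictly after `τₖ` (`StoppingSeq.sigma_le_determinedSigma`). Suppose `τₖ < τₖ₊₁` and shares are
held. Steer the path, just after `τₖ`, to a level adverse to the position. If the next trade comes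
only after that level is reached, it makes a loss. If it comes earlier, steer the path after that
trade into the open set `U`; the trade cannot anticipate this, so it happens on a path in `U` sooner
than the delay `ε` allows. Hence an adverse path always exists
(`StoppingSeq.HasDelay.exists_adverse_path`).

A non-negative value at `τₖ₊₁` therefore forbids an active position at `τₖ` when the value there is
at most zero. Backward induction makes all intermediate values non-negative, and forward induction
from zero makes them all vanish (`value_endTime_eq_zero`). -/

noncomputable section

namespace DelaySimple

/-! ### Riesz representation on the span of a family of vectors -/

section Hilbert

variable {V ι : Type*} [NormedAddCommGroup V] [InnerProductSpace ℝ V] [CompleteSpace V]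

/-- A function on the index set of a family of vectors, which is bounded by the norm of the
family, is represented by a vector. -/
theorem exists_inner_eq_of_sq_le (y : ι → V) (h : ι → ℝ) (C : ℝ)
    (hC : ∀ c : ι →₀ ℝ, (Finsupp.linearCombination ℝ h c) ^ 2 ≤
      C * ‖Finsupp.linearCombination ℝ y c‖ ^ 2) :
    ∃ ξ : V, ∀ t, inner ℝ ξ (y t) = h t := by
  set A := Finsupp.linearCombination ℝ y
  set L := Finsupp.linearCombination ℝ h
  -- The bound makes `L` descend to a bounded functional on the span of `y`; Hahn–Banach extends it
  -- and Riesz represents the extension.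
  have hker : LinearMap.ker A ≤ LinearMap.ker L := fun c hc => by
    have := hC c
    rw [LinearMap.mem_ker] at hc ⊢
    rw [hc] at this
    exact pow_eq_zero_iff two_ne_zero |>.1 (le_antisymm (by simpa using this) (sq_nonneg _))
  let ℓ : LinearMap.range A →ₗ[ℝ] ℝ :=
    ((LinearMap.ker A).liftQ L hker).comp A.quotKerEquivRange.symm.toLinearMap
  have hℓ : ∀ c, ℓ ⟨A c, c, rfl⟩ = L c := fun c => by
    have : A.quotKerEquivRange.symm ⟨A c, c, rfl⟩ = (LinearMap.ker A).mkQ c :=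
      A.quotKerEquivRange_symm_apply_image c _
    simp [ℓ, this]
  have hbd : ∀ x, ‖ℓ x‖ ≤ √C * ‖x‖ := by
    rintro ⟨_, c, rfl⟩
    rw [hℓ]
    have h1 := hC c
    refine Real.abs_le_sqrt h1 |>.trans ?_
    rw [Real.sqrt_mul' _ (sq_nonneg _), Real.sqrt_sq (norm_nonneg _)]
    rfl
  obtain ⟨g, hg, -⟩ := exists_extension_norm_eq _ (ℓ.mkContinuous _ hbd)
  refine ⟨(InnerProductSpace.toDual ℝ V).symm g, fun t => ?_⟩
  rw [InnerProductSpace.toDual_symm_apply]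
  have h1 : A (Finsupp.single t 1) = y t := by simp [A]
  have h2 := hg ⟨A (Finsupp.single t 1), _, rfl⟩
  rw [LinearMap.mkContinuous_apply, hℓ] at h2
  simpa [h1, L] using h2

end Hilbert

/-! ### Gaussian subspaces of L² and Cameron–Martin quasi-invariance -/

section Gaussian

variable {Ω I : Type*} [MeasurableSpace Ω] {P : Measure Ω}

/-- Lipschitz dependence on the L² variable makes the Gaussian form of the characteristic function a
closed condition, so it passes to limits of linear combinations. -/
theorem norm_sub_integral_exp_le [IsProbabilityMeasure P] (t : ℝ) (u w : Lp ℝ 2 P) :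
    ‖(∫ ω, Complex.exp (t * u ω * Complex.I) ∂P) - ∫ ω, Complex.exp (t * w ω * Complex.I) ∂P‖ ≤
      |t| * ‖u - w‖ := by
  have hint : ∀ u : Lp ℝ 2 P, Integrable (fun ω => Complex.exp (t * u ω * Complex.I)) P := by
    intro u
    refine Integrable.of_bound (C := 1) ?_ (Eventually.of_forall fun ω => ?_)
    · have := (Lp.stronglyMeasurable u).measurable
      exact (by fun_prop : Measurable _).aestronglyMeasurable
    · rw [← Complex.ofReal_mul, Complex.norm_exp_ofReal_mul_I]
  rw [← integral_sub (hint u) (hint w)]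
  have hmem : MemLp (fun ω => (u - w : Lp ℝ 2 P) ω) 2 P := Lp.memLp _
  calc _ ≤ ∫ ω, ‖Complex.exp (t * u ω * Complex.I) - Complex.exp (t * w ω * Complex.I)‖ ∂P :=
        norm_integral_le_integral_norm _
    _ ≤ ∫ ω, |t| * ‖(u - w : Lp ℝ 2 P) ω‖ ∂P := by
        refine integral_mono_ae ((hint u).sub (hint w)).norm
          ((hmem.integrable (by norm_num)).norm.const_mul _) ?_
        filter_upwards [Lp.coeFn_sub u w] with ω hω
        rw [hω, Pi.sub_apply]
        have h1 : Complex.exp (t * u ω * Complex.I) - Complex.exp (t * w ω * Complex.I) =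
            Complex.exp (t * w ω * Complex.I) *
              (Complex.exp (Complex.I * ((t * (u ω - w ω) : ℝ))) - 1) := by
          rw [mul_sub, ← Complex.exp_add, mul_one]
          congr 2
          push_cast
          ring
        rw [h1, norm_mul, ← Complex.ofReal_mul, Complex.norm_exp_ofReal_mul_I, one_mul]
        refine Real.norm_exp_I_mul_ofReal_sub_one_le.trans ?_
        rw [norm_mul, Real.norm_eq_abs]
    _ = |t| * ∫ ω, ‖(u - w : Lp ℝ 2 P) ω‖ ∂P := integral_const_mul _ _
    _ ≤ |t| * ‖u - w‖ := by
        gcongr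
        rw [← lpNorm_one_eq_integral_norm hmem.aestronglyMeasurable,
          ← toReal_eLpNorm hmem.aestronglyMeasurable, Lp.norm_def]
        exact ENNReal.toReal_mono (Lp.eLpNorm_ne_top _)
          (eLpNorm_le_eLpNorm_of_exponent_le (by norm_num) hmem.aestronglyMeasurable)

theorem integral_exp_of_hasGaussianLaw (u : Lp ℝ 2 P) (hu : HasGaussianLaw u P)
    (h0 : ∫ ω, u ω ∂P = 0) (t : ℝ) :
    ∫ ω, Complex.exp (t * u ω * Complex.I) ∂P = Complex.exp (-(t ^ 2 * ‖u‖ ^ 2 / 2 : ℝ)) := by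
  have h1 := hu.charFun_map_eq t
  have hm := (Lp.stronglyMeasurable u).measurable
  rw [charFun_apply_real, integral_map hm.aemeasurable (by fun_prop)] at h1
  rw [h1]
  have hv : Var[fun ω => inner ℝ t (u ω); P] = t ^ 2 * ‖u‖ ^ 2 := by
    have : (fun ω => inner ℝ t (u ω)) = fun ω => t * u ω := by
      ext ω; simp [mul_comm]
    rw [this, variance_const_mul, variance_of_integral_eq_zero hm.aemeasurable h0,
      ← real_inner_self_eq_norm_sq, L2.inner_def]
    congr 2
    ext ω
    simp [sq]
  have he : ∫ ω, inner ℝ t (u ω) ∂P = 0 := by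
    have : (fun ω => inner ℝ t (u ω)) = fun ω => t * u ω := by
      ext ω; simp [mul_comm]
    rw [this, integral_const_mul, h0, mul_zero]
  rw [hv, he]
  congr 1
  push_cast
  ring

theorem map_eq_gaussianReal_of_integral_exp [IsProbabilityMeasure P] (u : Lp ℝ 2 P)
    (hu : ∀ t : ℝ, ∫ ω, Complex.exp (t * u ω * Complex.I) ∂P =
      Complex.exp (-(t ^ 2 * ‖u‖ ^ 2 / 2 : ℝ))) :
    P.map u = gaussianReal 0 (‖u‖₊ ^ 2) := by
  have hm := (Lp.stronglyMeasurable u).measurable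
  have := Measure.isProbabilityMeasure_map (μ := P) hm.aemeasurable
  refine Measure.ext_of_charFun (funext fun t => ?_)
  rw [charFun_apply_real, integral_map hm.aemeasurable (by fun_prop), hu, charFun_gaussianReal]
  congr 1
  push_cast
  simp
  ring

/-- The elements of the closed linear span of a centered Gaussian process are Gaussian. -/
theorem map_eq_gaussianReal_of_mem_closure [IsProbabilityMeasure P] {y : I → Lp ℝ 2 P}
    (hy : IsGaussianProcess (fun t => ⇑(y t)) P) (h0 : ∀ t, ∫ ω, y t ω ∂P = 0) (u : Lp ℝ 2 P)
    (hu : u ∈ (Submodule.span ℝ (range y)).topologicalClosure) :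
    P.map u = gaussianReal 0 (‖u‖₊ ^ 2) := by
  refine map_eq_gaussianReal_of_integral_exp u fun t => ?_
  have hclosed : IsClosed {u : Lp ℝ 2 P | ∫ ω, Complex.exp (t * u ω * Complex.I) ∂P =
      Complex.exp (-(t ^ 2 * ‖u‖ ^ 2 / 2 : ℝ))} := by
    refine isClosed_eq ?_ (by fun_prop)
    have : LipschitzWith ‖t‖₊ fun u : Lp ℝ 2 P => ∫ ω, Complex.exp (t * u ω * Complex.I) ∂P :=
      LipschitzWith.of_dist_le_mul fun u w => by
        simpa [dist_eq_norm] using norm_sub_integral_exp_le t u w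
    exact this.continuous
  refine closure_minimal (fun w hw => ?_) hclosed hu
  obtain ⟨c, rfl⟩ := Finsupp.mem_span_range_iff_exists_finsupp.1 hw
  have hae : ⇑(c.sum fun i a => a • y i) =ᵐ[P] fun ω => ∑ i ∈ c.support, c i • y i ω := by
    rw [Finsupp.sum]
    refine (Lp.coeFn_finsetSum _ _).trans ?_
    have : ∀ᵐ ω ∂P, ∀ i ∈ c.support, (c i • y i : Lp ℝ 2 P) ω = c i • y i ω :=
      (ae_ball_iff c.support.countable_toSet).2 fun i _ => Lp.coeFn_smul _ _
    filter_upwards [this] with ω hω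
    rw [Finset.sum_apply]
    exact Finset.sum_congr rfl hω
  refine integral_exp_of_hasGaussianLaw _ ?_ ?_ t
  · refine HasGaussianLaw.congr ?_ hae.symm
    exact (hy.smul fun i => c i).hasGaussianLaw_fun_sum
  · rw [integral_congr_ae hae, integral_finsetSum]
    · simp [integral_const_mul, h0]
    · exact fun i _ => ((hy.hasGaussianLaw_eval i).integrable).smul (c i)

/-- A subspace of `L²` which consists of centered Gaussian variables is a Gaussian process. -/
theorem isGaussianProcess_submodule [IsProbabilityMeasure P] (V : Submodule ℝ (Lp ℝ 2 P))
    (hV : ∀ u ∈ V, P.map u = gaussianReal 0 (‖u‖₊ ^ 2)) :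
    IsGaussianProcess (fun (u : V) => ⇑(u : Lp ℝ 2 P)) P := by
  classical
  refine ⟨fun F => ⟨⟨fun L => ?_⟩⟩⟩
  set X : Ω → F → ℝ := fun ω => F.restrict fun u : V => (u : Lp ℝ 2 P) ω
  have hm : Measurable X :=
    measurable_pi_lambda _ fun u => (Lp.stronglyMeasurable _).measurable
  -- A linear form in finitely many elements of `V` is almost everywhere an element of `V`, hence
  -- Gaussian; this gives joint Gaussianity.
  set w : V := ∑ u : F, L (Pi.single u 1) • (u : V)
  have hae : L ∘ X =ᵐ[P] ⇑(w : Lp ℝ 2 P) := by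
    have h1 : (w : Lp ℝ 2 P) = ∑ u : F, L (Pi.single u 1) • ((u : V) : Lp ℝ 2 P) := by simp [w]
    rw [h1]
    refine EventuallyEq.trans ?_ (Lp.coeFn_finsetSum _ _).symm
    have : ∀ᵐ ω ∂P, ∀ u : F, (L (Pi.single u 1) • ((u : V) : Lp ℝ 2 P) : Lp ℝ 2 P) ω =
        L (Pi.single u 1) • ((u : V) : Lp ℝ 2 P) ω :=
      ae_all_iff.2 fun i => Lp.coeFn_smul _ _
    filter_upwards [this] with ω hω
    rw [Finset.sum_apply, Finset.sum_congr rfl fun u _ => hω u]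
    refine (LinearMap.pi_apply_eq_sum_univ L.toLinearMap (X ω)).trans
      (Finset.sum_congr rfl fun u _ => ?_)
    have : (Pi.single u 1 : F → ℝ) = fun j => if u = j then 1 else 0 := by
      ext j; simp [Pi.single_apply, eq_comm]
    rw [this, smul_eq_mul, smul_eq_mul, mul_comm]
    rfl
  have h2 : (P.map X).map L = gaussianReal 0 (‖(w : Lp ℝ 2 P)‖₊ ^ 2) := by
    rw [Measure.map_map L.continuous.measurable hm, Measure.map_congr hae, hV w w.2]
  have h3 : ∫ x, L x ∂(P.map X) = 0 := by
    have := integral_map (μ := P.map X) (φ := L) (f := id)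
      L.continuous.measurable.aemeasurable (by fun_prop)
    rw [h2] at this
    simpa using this.symm
  change (P.map X).map L = gaussianReal (∫ x, L x ∂(P.map X)) (Var[L; P.map X]).toNNReal
  rw [← variance_id_map (by fun_prop), h2, h3, variance_id_gaussianReal, Real.toNNReal_coe]

/-- The law of a centered Gaussian process is quasi-invariant under the translations by the
functions in the reproducing kernel Hilbert space of its covariance. -/
theorem measure_add_mem_eq_zero [IsProbabilityMeasure P] {x : I → Ω → ℝ} (hx : IsGaussianProcess x P)
    (hm : ∀ t, Measurable (x t)) (h0 : ∀ t, ∫ ω, x t ω ∂P = 0) (h : I → ℝ) (C : ℝ)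
    (hC : ∀ c : I →₀ ℝ, (c.sum fun t a => a * h t) ^ 2 ≤
      C * ∫ ω, (c.sum fun t a => a * x t ω) ^ 2 ∂P)
    {M : Set (I → ℝ)} (hM : MeasurableSet M) (hM0 : P {ω | (fun t => x t ω) ∈ M} = 0) :
    P {ω | (fun t => x t ω + h t) ∈ M} = 0 := by
  have hL : ∀ t, MemLp (x t) 2 P := fun t => (hx.hasGaussianLaw_eval t).memLp_two
  set y : I → Lp ℝ 2 P := fun t => (hL t).toLp (x t)
  have hyx : ∀ t, ⇑(y t) =ᵐ[P] x t := fun t => (hL t).coeFn_toLp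
  have hy : IsGaussianProcess (fun t => ⇑(y t)) P := hx.congr fun t => (hyx t).symm
  have hy0 : ∀ t, ∫ ω, y t ω ∂P = 0 := fun t => (integral_congr_ae (hyx t)).trans (h0 t)
  let V := (Submodule.span ℝ (range y)).topologicalClosure
  let y' : I → V := fun t => ⟨y t, Submodule.le_topologicalClosure _ (Submodule.subset_span ⟨t, rfl⟩)⟩
  obtain ⟨ξ, hξ⟩ : ∃ ξ : V, ∀ t, inner ℝ ξ (y' t) = h t := by
    refine exists_inner_eq_of_sq_le y' h C fun c => ?_
    have h1 : ‖Finsupp.linearCombination ℝ y' c‖ ^ 2 =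
        ∫ ω, (c.sum fun t a => a * x t ω) ^ 2 ∂P := by
      have h2 : ((Finsupp.linearCombination ℝ y' c : V) : Lp ℝ 2 P) =
          ∑ t ∈ c.support, c t • y t := by
        simp [Finsupp.linearCombination_apply, Finsupp.sum, y']
      have hae : ⇑((Finsupp.linearCombination ℝ y' c : V) : Lp ℝ 2 P) =ᵐ[P]
          fun ω => c.sum fun t a => a * x t ω := by
        rw [h2]
        refine (Lp.coeFn_finsetSum _ _).trans ?_
        have h3 : ∀ᵐ ω ∂P, ∀ i ∈ c.support, (c i • y i : Lp ℝ 2 P) ω = c i • y i ω :=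
          (ae_ball_iff c.support.countable_toSet).2 fun i _ => Lp.coeFn_smul _ _
        have h4 : ∀ᵐ ω ∂P, ∀ i ∈ c.support, y i ω = x i ω :=
          (ae_ball_iff c.support.countable_toSet).2 fun i _ => hyx i
        filter_upwards [h3, h4] with ω hω hω'
        rw [Finset.sum_apply, Finsupp.sum]
        exact Finset.sum_congr rfl fun i hi => by rw [hω i hi, hω' i hi, smul_eq_mul]
      change ‖((Finsupp.linearCombination ℝ y' c : V) : Lp ℝ 2 P)‖ ^ 2 = _
      rw [← real_inner_self_eq_norm_sq, L2.inner_def]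
      refine integral_congr_ae ?_
      filter_upwards [hae] with ω hω
      rw [hω]
      simp [sq]
    rw [h1]
    simpa [Finsupp.linearCombination_apply] using hC c
  by_cases hξ0 : ξ = 0
  · have : h = 0 := funext fun t => by rw [← hξ t, hξ0, inner_zero_left]; rfl
    simpa [this] using hM0
  have hv : ‖ξ‖ ^ 2 ≠ 0 := by simpa using hξ0
  -- Orthogonal decomposition `x = z' + k g` along `g = ξ`. The part `z'` is uncorrelated with `g`,
  -- hence independent of it, and adding `h = k ‖ξ‖²` to `x` amounts to adding the constant `‖ξ‖²`
  -- to `g`.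
  set k : I → ℝ := fun t => h t / ‖ξ‖ ^ 2
  let z : I → V := fun t => y' t - k t • ξ
  have hG := isGaussianProcess_submodule V (map_eq_gaussianReal_of_mem_closure hy hy0)
  set g : Ω → ℝ := ⇑(ξ : Lp ℝ 2 P)
  have hgm : Measurable g := (Lp.stronglyMeasurable _).measurable
  set z' : I → Ω → ℝ := fun t ω => x t ω - k t * g ω
  have hz' : ∀ t, z' t =ᵐ[P] ⇑(z t : Lp ℝ 2 P) := fun t => by
    have h1 : (z t : Lp ℝ 2 P) = y t - k t • (ξ : Lp ℝ 2 P) := rfl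
    rw [h1]
    filter_upwards [Lp.coeFn_sub (y t) (k t • (ξ : Lp ℝ 2 P)), Lp.coeFn_smul (k t) (ξ : Lp ℝ 2 P),
      hyx t] with ω h2 h3 h4
    rw [h2, Pi.sub_apply, h3, h4]
    rfl
  have hz'm : Measurable fun ω t => z' t ω :=
    measurable_pi_lambda _ fun t => (hm t).sub (hgm.const_mul _)
  have hind : IndepFun (fun ω t => z' t ω) g P := by
    have hjoint : IsGaussianProcess (Sum.elim z' fun _ : Unit => g) P := by
      refine (hG.comp_right (Sum.elim z fun _ : Unit => ξ)).congr ?_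
      rintro (t | t)
      · exact (hz' t).symm
      · rfl
    have := hjoint.indepFun_of_covariance_eq_zero
      (fun t => ((measurable_pi_apply t).comp hz'm).aemeasurable) (fun _ => hgm.aemeasurable) ?_
    · exact this.comp measurable_id (measurable_pi_apply ())
    intro t _
    have hg0 : ∫ ω, g ω ∂P = 0 := by
      have := map_eq_gaussianReal_of_mem_closure hy hy0 ξ ξ.2
      have h1 := integral_map (μ := P) hgm.aemeasurable (f := id) (by fun_prop)
      rw [this] at h1
      simpa using h1.symm
    have h1 : MemLp (z' t) 2 P := (Lp.memLp (z t : Lp ℝ 2 P)).ae_eq (hz' t).symm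
    rw [covariance_eq_sub h1 (Lp.memLp _), hg0, mul_zero, sub_zero]
    have h2 : inner ℝ (z t) ξ = ∫ ω, (z' t * g) ω ∂P := by
      rw [Submodule.coe_inner, L2.inner_def]
      refine integral_congr_ae ?_
      filter_upwards [hz' t] with ω hω
      rw [← hω]
      simp [g, mul_comm]
    have h3 : inner ℝ (k t • ξ) ξ = k t * ‖ξ‖ ^ 2 := by
      rw [← real_inner_self_eq_norm_sq]
      exact real_inner_smul_left (ξ : Lp ℝ 2 P) (ξ : Lp ℝ 2 P) (k t)
    rw [← h2, inner_sub_left, real_inner_comm, hξ, h3, div_mul_cancel₀ _ hv, sub_self]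
  have hmap := (indepFun_iff_map_prod_eq_prod_map_map hz'm.aemeasurable hgm.aemeasurable).1 hind
  have hind' : IndepFun (fun ω t => z' t ω) (fun ω => g ω + ‖ξ‖ ^ 2) P :=
    hind.comp measurable_id (measurable_id.add_const _)
  have hgm' : Measurable fun ω => g ω + ‖ξ‖ ^ 2 := hgm.add_const _
  have hmap' := (indepFun_iff_map_prod_eq_prod_map_map hz'm.aemeasurable hgm'.aemeasurable).1 hind'
  -- Nondegenerate Gaussian laws on the line are equivalent to Lebesgue measure, so no density
  -- formula is needed.
  have hac : P.map (fun ω => g ω + ‖ξ‖ ^ 2) ≪ P.map g := by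
    have h1 : P.map g = gaussianReal 0 (‖ξ‖₊ ^ 2) :=
      map_eq_gaussianReal_of_mem_closure hy hy0 ξ ξ.2
    have h2 : P.map (fun ω => g ω + ‖ξ‖ ^ 2) = gaussianReal (0 + ‖ξ‖ ^ 2) (‖ξ‖₊ ^ 2) := by
      rw [← gaussianReal_map_add_const, ← h1, Measure.map_map (by fun_prop) hgm]
      rfl
    have h3 : ‖ξ‖₊ ^ 2 ≠ 0 := by simpa using hξ0
    rw [h1, h2]
    exact (gaussianReal_absolutelyContinuous _ h3).trans (gaussianReal_absolutelyContinuous' _ h3)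
  have := Measure.isProbabilityMeasure_map (μ := P) hz'm.aemeasurable
  have := Measure.isProbabilityMeasure_map (μ := P) hgm.aemeasurable
  have := Measure.isProbabilityMeasure_map (μ := P) hgm'.aemeasurable
  let Ψ : (I → ℝ) × ℝ → I → ℝ := fun p t => p.1 t + k t * p.2
  have hΨ : Measurable Ψ := by fun_prop
  have hN : (P.map fun ω => ((fun t => z' t ω), g ω)) (Ψ ⁻¹' M) = 0 := by
    rw [Measure.map_apply (hz'm.prodMk hgm) (hΨ hM), ← hM0]
    congr 1
    ext ω
    simp [Ψ, z']
  have hN' : (P.map fun ω => ((fun t => z' t ω), g ω + ‖ξ‖ ^ 2)) (Ψ ⁻¹' M) = 0 := by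
    rw [hmap']
    rw [hmap] at hN
    exact (Measure.AbsolutelyContinuous.rfl.prod hac) hN
  rw [Measure.map_apply (hz'm.prodMk hgm') (hΨ hM)] at hN'
  rw [← hN']
  congr 1
  ext ω
  have : (fun t => x t ω + h t) = Ψ ((fun t => z' t ω), g ω + ‖ξ‖ ^ 2) := by
    ext t
    simp only [Ψ, z', k]
    field_simp
    ring
  simp [this]

end Gaussian

/-! ### Spectral representation of the fBm covariance -/

section Fourier

open scoped FourierTransform SchwartzMap

variable {H : ℝ}

/-- Near zero the integrand is of order `x ^ (1 - 2H)`, integrable since `H < 1`; at infinity it is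
of order `x ^ (-1 - 2H)`, integrable since `H > 0`. -/
theorem integrableOn_Ioi_one_sub_cos (hH : 0 < H) (hH1 : H < 1) :
    IntegrableOn (fun x : ℝ => (1 - Real.cos (2 * Real.pi * x)) * |x| ^ (-1 - 2 * H)) (Ioi 0) := by
  have hmeas : Measurable fun x : ℝ => (1 - Real.cos (2 * Real.pi * x)) * |x| ^ (-1 - 2 * H) := by
    fun_prop
  rw [← Ioc_union_Ioi_eq_Ioi zero_le_one]
  refine IntegrableOn.union ?_ ?_
  · have h1 : IntegrableOn (fun x : ℝ => (2 * Real.pi) ^ 2 / 2 * x ^ (1 - 2 * H)) (Ioc 0 1) :=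
      ((intervalIntegrable_iff_integrableOn_Ioc_of_le zero_le_one).1
        (intervalIntegral.intervalIntegrable_rpow' (by linarith))).const_mul _
    refine h1.mono' hmeas.aestronglyMeasurable ?_
    filter_upwards [ae_restrict_mem measurableSet_Ioc] with x hx
    have hx0 : 0 < x := hx.1
    have h2 := Real.one_sub_sq_div_two_le_cos (x := 2 * Real.pi * x)
    have h3 := Real.cos_le_one (2 * Real.pi * x)
    rw [Real.norm_of_nonneg (by have := Real.rpow_nonneg (abs_nonneg x) (-1 - 2 * H); nlinarith),
      abs_of_pos hx0]
    have h4 : x ^ (1 - 2 * H) = x ^ 2 * x ^ (-1 - 2 * H) := by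
      rw [← Real.rpow_natCast, ← Real.rpow_add hx0]
      congr 1
      push_cast
      ring
    rw [h4, ← mul_assoc]
    refine mul_le_mul_of_nonneg_right ?_ (Real.rpow_nonneg hx0.le _)
    nlinarith
  · have h1 : IntegrableOn (fun x : ℝ => 2 * x ^ (-1 - 2 * H)) (Ioi 1) :=
      (integrableOn_Ioi_rpow_of_lt (by linarith) one_pos).const_mul _
    refine h1.mono' hmeas.aestronglyMeasurable ?_
    filter_upwards [ae_restrict_mem measurableSet_Ioi] with x hx
    have hx0 : 0 < x := one_pos.trans hx
    have h2 := Real.neg_one_le_cos (2 * Real.pi * x)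
    have h3 := Real.cos_le_one (2 * Real.pi * x)
    rw [Real.norm_of_nonneg (by have := Real.rpow_nonneg (abs_nonneg x) (-1 - 2 * H); nlinarith),
      abs_of_pos hx0]
    exact mul_le_mul_of_nonneg_right (by linarith) (Real.rpow_nonneg hx0.le _)

theorem integrable_one_sub_cos (hH : 0 < H) (hH1 : H < 1) (s : ℝ) :
    Integrable fun x : ℝ => (1 - Real.cos (2 * Real.pi * (s * x))) * |x| ^ (-1 - 2 * H) := by
  have h0 : Integrable fun x : ℝ => (1 - Real.cos (2 * Real.pi * x)) * |x| ^ (-1 - 2 * H) := by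
    have h1 := integrableOn_Ioi_one_sub_cos hH hH1
    rw [← integrableOn_univ, ← Iic_union_Ioi (a := (0 : ℝ))]
    refine IntegrableOn.union ?_ h1
    have h2 := (integrableOn_Ici_iff_integrableOn_Ioi (μ := volume)).2 h1
    rw [← neg_zero] at h2
    simpa using h2.comp_neg_Iic
  rcases eq_or_ne s 0 with rfl | hs
  · simp
  have h1 := (h0.comp_mul_left' hs).mul_const (|s| ^ (1 + 2 * H))
  refine h1.congr (Eventually.of_forall fun x => ?_)
  simp only [abs_mul]
  rw [Real.mul_rpow (abs_nonneg _) (abs_nonneg _)]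
  have : |s| ^ (-1 - 2 * H) * |s| ^ (1 + 2 * H) = 1 := by
    rw [← Real.rpow_add (abs_pos.2 hs)]
    simp
  linear_combination (1 - Real.cos (2 * Real.pi * (s * x))) * |x| ^ (-1 - 2 * H) * this

/-- Scaling `x` by `s` shows that `|x| ^ (-1 - 2H)` is, up to a constant, the spectral density of
the variogram `|s| ^ (2H)`. -/
theorem integral_one_sub_cos (hH : 0 < H) (s : ℝ) :
    ∫ x : ℝ, (1 - Real.cos (2 * Real.pi * (s * x))) * |x| ^ (-1 - 2 * H) =
      |s| ^ (2 * H) * ∫ x : ℝ, (1 - Real.cos (2 * Real.pi * x)) * |x| ^ (-1 - 2 * H) := by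
  rcases eq_or_ne s 0 with rfl | hs
  · simp [Real.zero_rpow (by positivity : 2 * H ≠ 0)]
  have h1 := Measure.integral_comp_mul_left
    (fun x : ℝ => (1 - Real.cos (2 * Real.pi * x)) * |x| ^ (-1 - 2 * H)) s
  have hs' := abs_pos.2 hs
  have h2 : |s| ^ (2 * H) = |s| ^ (1 + 2 * H) * |s⁻¹| := by
    rw [abs_inv, Real.rpow_add hs', Real.rpow_one]
    field_simp
  rw [h2, mul_assoc, ← smul_eq_mul (|s⁻¹|), ← h1, ← integral_const_mul]
  congr 1
  ext x
  simp only [abs_mul]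
  rw [Real.mul_rpow (abs_nonneg _) (abs_nonneg _)]
  have : |s| ^ (-1 - 2 * H) * |s| ^ (1 + 2 * H) = 1 := by
    rw [← Real.rpow_add hs']
    simp
  linear_combination -(1 - Real.cos (2 * Real.pi * (s * x))) * |x| ^ (-1 - 2 * H) * this

/-- Polarization: integrated against the spectral density, each summand becomes a multiple of the
fBm covariance. -/
theorem norm_sq_sum_exp_sub_one {ι : Type*} (F : Finset ι) (c s : ι → ℝ) (x : ℝ) :
    ‖∑ i ∈ F, (c i : ℂ) * (Complex.exp ((2 * Real.pi * (s i * x) : ℝ) * Complex.I) - 1)‖ ^ 2 =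
      ∑ i ∈ F, ∑ j ∈ F, c i * c j * ((1 - Real.cos (2 * Real.pi * (s i * x))) +
        (1 - Real.cos (2 * Real.pi * (s j * x))) -
        (1 - Real.cos (2 * Real.pi * ((s i - s j) * x)))) := by
  rw [← Complex.normSq_eq_norm_sq, Complex.normSq_apply, Complex.re_sum, Complex.im_sum]
  simp only [Complex.re_ofReal_mul, Complex.im_ofReal_mul, Complex.sub_re, Complex.sub_im,
    Complex.exp_ofReal_mul_I_re, Complex.exp_ofReal_mul_I_im, Complex.one_re, Complex.one_im]
  rw [Finset.sum_mul_sum, Finset.sum_mul_sum, ← Finset.sum_add_distrib]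
  refine Finset.sum_congr rfl fun i _ => ?_
  rw [← Finset.sum_add_distrib]
  refine Finset.sum_congr rfl fun j _ => ?_
  have : 2 * Real.pi * ((s i - s j) * x) = 2 * Real.pi * (s i * x) - 2 * Real.pi * (s j * x) := by
    ring
  rw [this, Real.cos_sub]
  ring

/-- A Schwartz function which vanishes at the origin belongs to the reproducing kernel Hilbert
space of fractional Brownian motion. -/
theorem exists_norm_sq_sum_le (hH : 0 < H) (hH1 : H < 1) (f : 𝓢(ℝ, ℂ)) (hf : f 0 = 0)
    (ι : Type*) : ∃ C : ℝ, 0 ≤ C ∧ ∀ (F : Finset ι) (c s : ι → ℝ),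
      ‖∑ i ∈ F, (c i : ℂ) * f (s i)‖ ^ 2 ≤ C * ∑ i ∈ F, ∑ j ∈ F, c i * c j *
        ((|s i| ^ (2 * H) + |s j| ^ (2 * H) - |s i - s j| ^ (2 * H)) / 2) := by
  set G : 𝓢(ℝ, ℂ) := 𝓕 f
  have hGi : Integrable G := G.integrable
  have hinv : ∀ s, f s = ∫ x, Complex.exp ((2 * Real.pi * (s * x) : ℝ) * Complex.I) * G x := by
    intro s
    have h1 : 𝓕⁻ G = f := FourierTransform.fourierInv_fourier_eq f
    rw [← h1, SchwartzMap.fourierInv_coe, Real.fourierInv_eq']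
    simp [mul_comm]
  have hexp : ∀ s : ℝ, Integrable fun x : ℝ =>
      Complex.exp ((2 * Real.pi * (s * x) : ℝ) * Complex.I) * G x := fun s =>
    hGi.bdd_mul (c := 1) (Continuous.aestronglyMeasurable (by fun_prop))
      (Eventually.of_forall fun x => by rw [Complex.norm_exp_ofReal_mul_I])
  -- Since `f 0 = 0`, the exponential in the inversion formula may be replaced by the exponential
  -- minus one, which tames the singular weight at the origin.
  have hG0 : ∫ x, G x = 0 := by
    rw [← hf, hinv 0]
    simp
  obtain ⟨M, hM0, hM⟩ := G.decay 0 0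
  simp only [pow_zero, one_mul, norm_iteratedFDeriv_zero] at hM
  -- The weight `|x| ^ (1/2 + H)` goes to `G` and its inverse to the trigonometric sum `D`.
  -- Cauchy–Schwarz then bounds the pairing by `∫ b²`, finite by rapid decay, times `∫ a²`, which is
  -- `2J` times the covariance form.
  set b : ℝ → ℝ := fun x => ‖G x‖ * |x| ^ (1 / 2 + H)
  have hbm : Measurable b := by
    have := G.continuous
    fun_prop
  have hb2 : ∀ x, b x ^ 2 = ‖G x‖ ^ 2 * |x| ^ (1 + 2 * H) := fun x => by
    rw [mul_pow, ← Real.rpow_mul_natCast (abs_nonneg _)]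
    congr 2
    push_cast
    ring
  have hb : MemLp b 2 := by
    rw [memLp_two_iff_integrable_sq hbm.aestronglyMeasurable]
    have h1 := ((G.integrable_pow_mul volume 0).add (G.integrable_pow_mul volume 3)).const_mul M
    refine h1.mono' (hbm.pow_const _).aestronglyMeasurable (Eventually.of_forall fun x => ?_)
    rw [Real.norm_of_nonneg (sq_nonneg _), hb2]
    have h2 : |x| ^ (1 + 2 * H) ≤ 1 + |x| ^ 3 := by
      rcases le_total |x| 1 with h | h
      · have := Real.rpow_le_one (abs_nonneg x) h (by linarith : 0 ≤ 1 + 2 * H)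
        have : 0 ≤ |x| ^ 3 := by positivity
        linarith
      · have := Real.rpow_le_rpow_of_exponent_le h (by push_cast; linarith : 1 + 2 * H ≤ (3 : ℕ))
        rw [Real.rpow_natCast] at this
        linarith
    calc ‖G x‖ ^ 2 * |x| ^ (1 + 2 * H) ≤ (M * ‖G x‖) * (1 + |x| ^ 3) := by
          rw [sq]
          gcongr
          exact hM x
      _ = _ := by simp; ring
  set J := ∫ x : ℝ, (1 - Real.cos (2 * Real.pi * x)) * |x| ^ (-1 - 2 * H)
  have hJ : 0 ≤ J := integral_nonneg fun x =>
    mul_nonneg (by linarith [Real.cos_le_one (2 * Real.pi * x)]) (Real.rpow_nonneg (abs_nonneg _) _)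
  have hB : 0 ≤ ∫ x, b x ^ 2 := integral_nonneg fun x => sq_nonneg _
  refine ⟨(∫ x, b x ^ 2) * (2 * J), by positivity, fun F c s => ?_⟩
  set D : ℝ → ℂ := fun x =>
    ∑ i ∈ F, (c i : ℂ) * (Complex.exp ((2 * Real.pi * (s i * x) : ℝ) * Complex.I) - 1)
  have hDc : Continuous D := by fun_prop
  have hsum : ∑ i ∈ F, (c i : ℂ) * f (s i) = ∫ x, D x * G x := by
    have h1 : ∀ i ∈ F, (c i : ℂ) * f (s i) = ∫ x, (c i : ℂ) *
        (Complex.exp ((2 * Real.pi * (s i * x) : ℝ) * Complex.I) * G x - G x) := fun i _ => by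
      rw [integral_const_mul, integral_sub (hexp _) hGi, hG0, sub_zero, hinv]
    rw [Finset.sum_congr rfl h1, ← integral_finsetSum]
    · congr 1
      ext x
      rw [Finset.sum_mul]
      exact Finset.sum_congr rfl fun i _ => by ring
    · exact fun i _ => ((hexp _).sub hGi).const_mul _
  set a : ℝ → ℝ := fun x => ‖D x‖ * |x| ^ (-(1 / 2) - H)
  have ham : Measurable a := by fun_prop
  have ha2 : ∀ x, a x ^ 2 = ∑ i ∈ F, ∑ j ∈ F, c i * c j *
      ((1 - Real.cos (2 * Real.pi * (s i * x))) * |x| ^ (-1 - 2 * H) +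
        (1 - Real.cos (2 * Real.pi * (s j * x))) * |x| ^ (-1 - 2 * H) -
        (1 - Real.cos (2 * Real.pi * ((s i - s j) * x))) * |x| ^ (-1 - 2 * H)) := fun x => by
    have h1 : (|x| ^ (-(1 / 2) - H)) ^ 2 = |x| ^ (-1 - 2 * H) := by
      rw [← Real.rpow_mul_natCast (abs_nonneg _)]
      congr 1
      push_cast
      ring
    rw [mul_pow, norm_sq_sum_exp_sub_one, h1, Finset.sum_mul]
    refine Finset.sum_congr rfl fun i _ => ?_
    rw [Finset.sum_mul]
    exact Finset.sum_congr rfl fun j _ => by ring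
  have hint : ∀ i j, Integrable fun x : ℝ => c i * c j *
      ((1 - Real.cos (2 * Real.pi * (s i * x))) * |x| ^ (-1 - 2 * H) +
        (1 - Real.cos (2 * Real.pi * (s j * x))) * |x| ^ (-1 - 2 * H) -
        (1 - Real.cos (2 * Real.pi * ((s i - s j) * x))) * |x| ^ (-1 - 2 * H)) := fun i j =>
    (((integrable_one_sub_cos hH hH1 _).add (integrable_one_sub_cos hH hH1 _)).sub
      (integrable_one_sub_cos hH hH1 _)).const_mul _
  have ha : MemLp a 2 := by
    rw [memLp_two_iff_integrable_sq ham.aestronglyMeasurable]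
    simp_rw [ha2]
    exact integrable_finsetSum _ fun i _ => integrable_finsetSum _ fun j _ => hint i j
  have haI : ∫ x, a x ^ 2 = 2 * J * ∑ i ∈ F, ∑ j ∈ F, c i * c j *
        ((|s i| ^ (2 * H) + |s j| ^ (2 * H) - |s i - s j| ^ (2 * H)) / 2) := by
    simp_rw [ha2]
    rw [integral_finsetSum _ fun i _ => integrable_finsetSum _ fun j _ => hint i j, Finset.mul_sum]
    refine Finset.sum_congr rfl fun i _ => ?_
    rw [integral_finsetSum _ fun j _ => hint i j, Finset.mul_sum]
    refine Finset.sum_congr rfl fun j _ => ?_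
    have hi := integrable_one_sub_cos hH hH1
    have hij : Integrable fun x : ℝ =>
        (1 - Real.cos (2 * Real.pi * (s i * x))) * |x| ^ (-1 - 2 * H) +
        (1 - Real.cos (2 * Real.pi * (s j * x))) * |x| ^ (-1 - 2 * H) := (hi _).add (hi _)
    rw [integral_const_mul, integral_sub hij (hi _), integral_add (hi _) (hi _),
      integral_one_sub_cos hH, integral_one_sub_cos hH, integral_one_sub_cos hH]
    ring
  have hle : ‖∫ x, D x * G x‖ ≤ ∫ x, a x * b x := by
    refine (norm_integral_le_integral_norm _).trans_eq (integral_congr_ae ?_)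
    filter_upwards [compl_mem_ae_iff.2 (measure_singleton (0 : ℝ))] with x hx
    have hx' : 0 < |x| := abs_pos.2 hx
    have : |x| ^ (-(1 / 2) - H) * |x| ^ (1 / 2 + H) = 1 := by
      rw [← Real.rpow_add hx']
      simp
    rw [norm_mul]
    linear_combination -‖D x‖ * ‖G x‖ * this
  have hCS := integral_mul_le_Lp_mul_Lq_of_nonneg (μ := (volume : Measure ℝ))
    Real.HolderConjugate.two_two (Eventually.of_forall fun x => by positivity : 0 ≤ᵐ[volume] a)
    (Eventually.of_forall fun x => by positivity : 0 ≤ᵐ[volume] b) (by simpa using ha)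
    (by simpa using hb)
  simp only [Real.rpow_two, ← Real.sqrt_eq_rpow] at hCS
  rw [hsum, mul_assoc, ← haI]
  calc ‖∫ x, D x * G x‖ ^ 2 ≤ (√(∫ x, a x ^ 2) * √(∫ x, b x ^ 2)) ^ 2 := by
        gcongr
        exact hle.trans hCS
    _ = _ := by
        rw [mul_pow, Real.sq_sqrt (integral_nonneg fun x => sq_nonneg _), Real.sq_sqrt hB, mul_comm]

end Fourier

/-! ### Multiplicative shifts of price paths -/

section Shift

variable {T s₀ : ℝ}

/-- The continuous functions on `[0, T]` which vanish at the origin. -/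
abbrev NullStart (T : ℝ) : Type :=
  {g : C(Set.Icc (0 : ℝ) T, ℝ) // ∀ t : Set.Icc (0 : ℝ) T, (t : ℝ) = 0 → g t = 0}

/-- The path `ω exp(g)`. -/
def PosPath.shift (ω : PosPath 0 T s₀) (g : NullStart T) : PosPath 0 T s₀ :=
  ⟨⟨fun t => ω t * Real.exp (g.1 t), by
      have h1 := ω.1.continuous
      have h2 := g.1.continuous
      fun_prop⟩,
    fun t => mul_pos (ω.2.1 t) (Real.exp_pos _), fun t ht => by
      change ω t * Real.exp (g.1 t) = s₀
      rw [g.2 t ht, Real.exp_zero, mul_one, ω.2.2 t ht]⟩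

theorem PosPath.shift_apply (ω : PosPath 0 T s₀) (g : NullStart T) (t : Set.Icc (0 : ℝ) T) :
    ω.shift g t = ω t * Real.exp (g.1 t) := rfl

theorem PosPath.log_shift (ω : PosPath 0 T s₀) (g : NullStart T) (t : Set.Icc (0 : ℝ) T) :
    Real.log (ω.shift g t) = Real.log (ω t) + g.1 t := by
  rw [shift_apply, Real.log_mul (ω.2.1 t).ne' (Real.exp_pos _).ne', Real.log_exp]

theorem PosPath.measurable_eval (t : Set.Icc (0 : ℝ) T) :
    Measurable fun ω : PosPath 0 T s₀ => ω t :=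
  Measurable.of_comap_le (le_iSup (fun t : Set.Icc (0 : ℝ) T =>
    MeasurableSpace.comap (fun f : PosPath 0 T s₀ => f t) inferInstance) t)

/-- The law `P` is quasi-invariant under the shifts by a countable family of functions, in which
the functions which vanish up to a given time are dense. -/
def HasShifts (P : Measure (PosPath 0 T s₀)) : Prop :=
  ∃ 𝒢 : Set (NullStart T), 𝒢.Countable ∧
    (∀ g ∈ 𝒢, ∀ N : Set (PosPath 0 T s₀), P N = 0 → P {ω | ω.shift g ∈ N} = 0) ∧
    ∀ a b : Set.Icc (0 : ℝ) T, a < b → ∀ f : C(Set.Icc (0 : ℝ) T, ℝ), (∀ t ≤ b, f t = 0) →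
      ∀ r > 0, ∃ g ∈ 𝒢, (∀ t ≤ a, g.1 t = 0) ∧ ∀ t, |g.1 t - f t| < r

end Shift

/-! ### Smooth approximation without a change of the past -/

section Density

variable {T : ℝ}

theorem exists_contDiff_approx {a b : Set.Icc (0 : ℝ) T} (hab : a < b)
    (f : C(Set.Icc (0 : ℝ) T, ℝ)) (hf : ∀ t ≤ b, f t = 0) {r : ℝ} (hr : 0 < r) :
    ∃ h : ℝ → ℝ, ContDiff ℝ (⊤ : ℕ∞) h ∧ HasCompactSupport h ∧ (∀ x ≤ (a : ℝ), h x = 0) ∧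
      ∀ t : Set.Icc (0 : ℝ) T, |h t - f t| < r := by
  have hT : 0 ≤ T := a.2.1.trans a.2.2
  -- Constant extension beyond `T`, cut off linearly to vanish from `T + 1` on.
  set F : ℝ → ℝ := fun x => Set.IccExtend hT f x * max 0 (min 1 (T + 1 - x))
  have hFc : Continuous F := by
    have : Continuous (Set.IccExtend hT f) := f.continuous.Icc_extend'
    fun_prop
  have hF0 : ∀ x ≤ (b : ℝ), F x = 0 := fun x hx => by
    have : Set.projIcc 0 T hT x ≤ b := by
      have := Set.monotone_projIcc hT hx
      rwa [Set.projIcc_val] at this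
    simp only [F, Set.IccExtend, Function.comp_apply]
    rw [hf _ this, zero_mul]
  have hF1 : ∀ x, T + 1 ≤ x → F x = 0 := fun x hx => by
    have : max 0 (min 1 (T + 1 - x)) = 0 := max_eq_left ((min_le_right _ _).trans (by linarith))
    simp only [F, this, mul_zero]
  have hFf : ∀ t : Set.Icc (0 : ℝ) T, F t = f t := fun t => by
    have : max 0 (min 1 (T + 1 - (t : ℝ))) = 1 := by
      rw [min_eq_left (by linarith [t.2.2]), max_eq_right zero_le_one]
    simp only [F, this, mul_one]
    exact Set.IccExtend_val hT f t
  have hFs : HasCompactSupport F := HasCompactSupport.intro (isCompact_Icc (a := 0) (b := T + 1))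
    fun x hx => by
      by_contra h
      refine hx ⟨le_of_not_gt fun h1 => h (hF0 x (h1.le.trans b.2.1)),
        le_of_not_gt fun h1 => h (hF1 x h1.le)⟩
  obtain ⟨δ, hδ, hFδ⟩ := Metric.uniformContinuous_iff.1
    (hFs.uniformContinuous_of_continuous hFc) (r / 2) (half_pos hr)
  have hab' : (a : ℝ) < b := hab
  -- Smoothing at a scale of at most `b - a` keeps the function zero up to `a`.
  obtain ⟨g, hg, hg'⟩ := hFc.exists_contDiff_dist_le_of_forall_mem_ball_dist_le
    (lt_min hδ (sub_pos.2 hab'))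
  have hg0 : ∀ x ≤ (a : ℝ), g x = 0 := fun x hx => by
    have := hg' x 0 fun y hy => by
      have h1 := (abs_lt.1 (Metric.mem_ball.1 hy)).2
      have h2 := min_le_right δ ((b : ℝ) - a)
      rw [hF0 y (by linarith), hF0 x (by linarith), dist_self]
    rw [hF0 x (by linarith)] at this
    exact dist_le_zero.1 this
  refine ⟨g, hg, HasCompactSupport.intro (isCompact_Icc (a := 0) (b := T + 1 + δ)) fun x hx => ?_,
    hg0, fun t => ?_⟩
  · rcases lt_or_ge x 0 with h | h
    · exact hg0 x (h.le.trans a.2.1)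
    · have hx' : T + 1 + δ < x := lt_of_not_ge fun h1 => hx ⟨h, h1⟩
      have := hg' x 0 fun y hy => by
        have h1 := (abs_lt.1 (Metric.mem_ball.1 hy)).1
        have h2 := min_le_left δ ((b : ℝ) - a)
        rw [hF1 y (by linarith), hF1 x (by linarith), dist_self]
      rw [hF1 x (by linarith)] at this
      exact dist_le_zero.1 this
  · rw [← hFf t, ← Real.dist_eq]
    refine (hg' t (r / 2) fun y hy => (hFδ ?_).le).trans_lt (half_lt_self hr)
    exact (Metric.mem_ball.1 hy).trans_le (min_le_left _ _)

end Density

/-! ### From Gaussian translations to shifts of the price law -/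

section Law

variable {T s₀ : ℝ} {E : Type*} [MeasurableSpace E] {Q : Measure E} [IsProbabilityMeasure Q]

/-- The covariance function of fractional Brownian motion. -/
def fBmKernel (H : ℝ) (s t : ℝ) : ℝ := (|s| ^ (2 * H) + |t| ^ (2 * H) - |s - t| ^ (2 * H)) / 2

theorem measure_shift_eq_zero (hs₀ : 0 < s₀) {P : Measure (PosPath 0 T s₀)}
    {Z : Set.Icc (0 : ℝ) T → E → ℝ} (hZ : IsGaussianProcess Z Q) (hZ0 : ∀ t, ∫ e, Z t e ∂Q = 0)
    (m : Set.Icc (0 : ℝ) T → ℝ)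
    (hP : IsPathLaw (fun t e => s₀ * Real.exp (m t + Z t e)) Q P)
    (g : NullStart T) (C : ℝ)
    (hC : ∀ c : Set.Icc (0 : ℝ) T →₀ ℝ, (c.sum fun t a => a * g.1 t) ^ 2 ≤
      C * ∫ e, (c.sum fun t a => a * Z t e) ^ 2 ∂Q)
    (N : Set (PosPath 0 T s₀)) (hN : P N = 0) : P {ω | ω.shift g ∈ N} = 0 := by
  obtain ⟨X, hX, hXS⟩ := hP
  have hPp : IsProbabilityMeasure P := by
    rw [← hX.map_eq]
    exact Measure.isProbabilityMeasure_map hX.aemeasurable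
  set x : Set.Icc (0 : ℝ) T → PosPath 0 T s₀ → ℝ := fun t ω => Real.log (ω t) - Real.log s₀ - m t
  have hxm : ∀ t, Measurable (x t) := fun t =>
    ((Real.measurable_log.comp (PosPath.measurable_eval t)).sub_const _).sub_const _
  have hxZ : ∀ t, x t ∘ X =ᵐ[Q] Z t := fun t => by
    filter_upwards [hXS t] with e he
    simp only [x, Function.comp_apply, he]
    rw [Real.log_mul hs₀.ne' (Real.exp_pos _).ne', Real.log_exp]
    ring
  have hxg : IsGaussianProcess x P := by
    refine ⟨fun F => ⟨?_⟩⟩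
    have h1 : Measurable fun ω => F.restrict fun t => x t ω :=
      measurable_pi_lambda _ fun t => hxm t
    have h2 : (fun ω => F.restrict fun t => x t ω) ∘ X =ᵐ[Q] fun e => F.restrict fun t => Z t e := by
      have : ∀ᵐ e ∂Q, ∀ t : F, x t (X e) = Z t e := ae_all_iff.2 fun t => hxZ t
      filter_upwards [this] with e he
      exact funext he
    have h3 : P.map (fun ω => F.restrict fun t => x t ω) =
        Q.map fun e => F.restrict fun t => Z t e := by
      rw [← hX.map_eq, AEMeasurable.map_map_of_aemeasurable h1.aemeasurable hX.aemeasurable]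
      exact Measure.map_congr h2
    rw [h3]
    exact (hZ.hasGaussianLaw F).isGaussian_map
  have hx0 : ∀ t, ∫ ω, x t ω ∂P = 0 := fun t => by
    rw [← hX.map_eq, integral_map hX.aemeasurable (hxm t).aestronglyMeasurable, ← hZ0 t]
    exact integral_congr_ae (hxZ t)
  have hxs : ∀ c : Set.Icc (0 : ℝ) T →₀ ℝ, ∫ ω, (c.sum fun t a => a * x t ω) ^ 2 ∂P =
      ∫ e, (c.sum fun t a => a * Z t e) ^ 2 ∂Q := fun c => by
    have h1 : Measurable fun ω => (c.sum fun t a => a * x t ω) ^ 2 :=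
      (Finset.measurable_fun_sum _ fun t _ => (hxm t).const_mul _).pow_const _
    rw [← hX.map_eq, integral_map hX.aemeasurable h1.aestronglyMeasurable]
    refine integral_congr_ae ?_
    have : ∀ᵐ e ∂Q, ∀ t ∈ c.support, x t (X e) = Z t e :=
      (ae_ball_iff c.support.countable_toSet).2 fun t _ => hxZ t
    filter_upwards [this] with e he
    congr 1
    exact Finset.sum_congr rfl fun t ht => congrArg (c t * ·) (he t ht)
  -- The centered log-prices generate the cylinder σ-algebra, so a measurable null cover of `N` is
  -- the preimage of a measurable set of real functions of time.
  have hle : PosPath.cylinderSigma 0 T s₀ ≤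
      MeasurableSpace.comap (fun ω t => x t ω) MeasurableSpace.pi := by
    refine iSup_le fun t => ?_
    rw [← measurable_iff_comap_le]
    have h1 : Measurable[MeasurableSpace.comap (fun ω t => x t ω) MeasurableSpace.pi] (x t) :=
      (measurable_pi_apply t).comp (comap_measurable fun ω t => x t ω)
    have h2 : (fun ω : PosPath 0 T s₀ => ω t) = fun ω => Real.exp (x t ω + m t + Real.log s₀) := by
      ext ω
      simp only [x]
      rw [sub_add_cancel, sub_add_cancel, Real.exp_log (ω.2.1 t)]
    rw [h2]
    exact Real.measurable_exp.comp ((h1.add_const _).add_const _)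
  obtain ⟨M, hM, hMN⟩ := hle _ (measurableSet_toMeasurable P N)
  have hM0 : P {ω | (fun t => x t ω) ∈ M} = 0 := by
    have : {ω | (fun t => x t ω) ∈ M} = toMeasurable P N := hMN
    rw [this, measure_toMeasurable, hN]
  have := measure_add_mem_eq_zero hxg hxm hx0 (fun t => g.1 t) C (fun c => by
    rw [hxs]; exact hC c) hM hM0
  refine measure_mono_null (fun ω hω => ?_) this
  have h1 : ω.shift g ∈ (fun ω t => x t ω) ⁻¹' M := hMN ▸ subset_toMeasurable P N hω
  have h2 : (fun t => x t (ω.shift g)) = fun t => x t ω + g.1 t := by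
    ext t
    simp only [x]
    rw [PosPath.log_shift]
    ring
  rw [mem_preimage, h2] at h1
  exact h1

/-- Domination of covariances gives inclusion of reproducing kernel spaces, so smooth compactly
supported functions vanishing at the origin are admissible. Separability of the function space
reduces them to a countable family. -/
theorem hasShifts_of_kernel_le (hs₀ : 0 < s₀) {P : Measure (PosPath 0 T s₀)}
    {Z : Set.Icc (0 : ℝ) T → E → ℝ} (hZ : IsGaussianProcess Z Q) (hZ0 : ∀ t, ∫ e, Z t e ∂Q = 0)
    (m : Set.Icc (0 : ℝ) T → ℝ)
    (hP : IsPathLaw (fun t e => s₀ * Real.exp (m t + Z t e)) Q P)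
    {H κ : ℝ} (hH : 0 < H) (hH1 : H < 1) (hκ : 0 < κ)
    (hK : ∀ (F : Finset (Set.Icc (0 : ℝ) T)) (c : Set.Icc (0 : ℝ) T → ℝ),
      κ * ∑ i ∈ F, ∑ j ∈ F, c i * c j * fBmKernel H i j ≤ ∫ e, (∑ i ∈ F, c i * Z i e) ^ 2 ∂Q) :
    HasShifts P := by
  set 𝒢₀ : Set (NullStart T) :=
    {g | ∀ N : Set (PosPath 0 T s₀), P N = 0 → P {ω | ω.shift g ∈ N} = 0}
  have hsmooth : ∀ (h : ℝ → ℝ) (hc : ContDiff ℝ (⊤ : ℕ∞) h) (hs : HasCompactSupport h) (h0 : h 0 = 0),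
      (⟨⟨fun t => h t, hc.continuous.comp continuous_subtype_val⟩,
        fun t ht => by simp [ht, h0]⟩ : NullStart T) ∈ 𝒢₀ := by
    intro h hc hs h0
    have hs' : HasCompactSupport fun x => (h x : ℂ) := hs.comp_left Complex.ofReal_zero
    let f := hs'.toSchwartzMap (Complex.ofRealCLM.contDiff.comp hc)
    have hf : ∀ x, f x = h x := fun x => rfl
    obtain ⟨C, hC0, hC⟩ := exists_norm_sq_sum_le hH hH1 f (by simp [hf, h0]) (Set.Icc (0 : ℝ) T)
    refine measure_shift_eq_zero hs₀ hZ hZ0 m hP _ (C / κ) fun c => ?_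
    have h1 := hC c.support c (fun t => t)
    have h2 : ‖∑ i ∈ c.support, (c i : ℂ) * f (i : ℝ)‖ ^ 2 =
        (c.sum fun t a => a * h t) ^ 2 := by
      have : ∑ i ∈ c.support, (c i : ℂ) * f (i : ℝ) = ((c.sum fun t a => a * h t : ℝ) : ℂ) := by
        rw [Finsupp.sum]
        push_cast
        rfl
      rw [this, Complex.norm_real, Real.norm_eq_abs, sq_abs]
    rw [h2] at h1
    refine h1.trans ?_
    rw [div_mul_eq_mul_div, le_div_iff₀ hκ, mul_assoc]
    refine mul_le_mul_of_nonneg_left ?_ hC0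
    rw [mul_comm]
    exact hK c.support c
  obtain ⟨D, hDc, hDd⟩ := TopologicalSpace.exists_countable_dense (Set.Icc (0 : ℝ) T)
  -- The dense subset is chosen inside the shifts vanishing up to `a`, so that approximation
  -- preserves the past; only `a` in the countable set `D` are kept.
  have hsep : ∀ a : Set.Icc (0 : ℝ) T, ∃ 𝒟 ⊆ {g ∈ 𝒢₀ | ∀ t ≤ a, g.1 t = 0}, 𝒟.Countable ∧
      {g ∈ 𝒢₀ | ∀ t ≤ a, g.1 t = 0} ⊆ closure 𝒟 := fun a =>
    (TopologicalSpace.IsSeparable.of_separableSpace _).exists_countable_dense_subset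
  choose 𝒟 h𝒟 h𝒟c h𝒟d using hsep
  refine ⟨⋃ a ∈ D, 𝒟 a, hDc.biUnion fun a _ => h𝒟c a, fun g hg => ?_, ?_⟩
  · obtain ⟨a, ha, hg⟩ := mem_iUnion₂.1 hg
    exact fun N hN => (h𝒟 a hg).1 N hN
  intro a b hab f hf r hr
  obtain ⟨d, hd, hdb⟩ := hDd.exists_between hab
  obtain ⟨h, hc, hs, h0, hfh⟩ := exists_contDiff_approx hdb.2 f hf (half_pos hr)
  have hh := hsmooth h hc hs (h0 0 d.2.1)
  obtain ⟨g, hg, hgh⟩ := Metric.mem_closure_iff.1 (h𝒟d d ⟨hh, fun t ht => h0 t ht⟩) (r / 2)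
    (half_pos hr)
  refine ⟨g, mem_biUnion hd hg, fun t ht => (h𝒟 d hg).2 t (ht.trans hdb.1.le), fun t => ?_⟩
  have h1 : |h t - g.1 t| < r / 2 := (ContinuousMap.dist_apply_le_dist t).trans_lt hgh
  have h2 := hfh t
  rw [abs_lt] at *
  constructor <;> linarith [h1.1, h1.2, h2.1, h2.2]

end Law

/-! ### Covariance bounds for the three models -/

section ModelLaws

variable {T s₀ : ℝ} {E : Type*} [MeasurableSpace E] {Q : Measure E}

theorem IsFBm.integral_sum_sq {H : ℝ} {B : Set.Icc (0 : ℝ) T → E → ℝ} (hB : IsFBm H B Q)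
    (F : Finset (Set.Icc (0 : ℝ) T)) (c : Set.Icc (0 : ℝ) T → ℝ) :
    ∫ e, (∑ i ∈ F, c i * B i e) ^ 2 ∂Q = ∑ i ∈ F, ∑ j ∈ F, c i * c j * fBmKernel H i j := by
  have := hB.gaussian.isProbabilityMeasure
  have hL : ∀ t, MemLp (B t) 2 Q := fun t => (hB.gaussian.hasGaussianLaw_eval t).memLp_two
  have hint : ∀ i j, Integrable (fun e => c i * B i e * (c j * B j e)) Q := fun i j =>
    ((hL i).const_mul (c i)).integrable_mul ((hL j).const_mul (c j))
  simp_rw [sq, Finset.sum_mul_sum]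
  rw [integral_finsetSum _ fun i _ => integrable_finsetSum _ fun j _ => hint i j]
  refine Finset.sum_congr rfl fun i _ => ?_
  rw [integral_finsetSum _ fun j _ => hint i j]
  refine Finset.sum_congr rfl fun j _ => ?_
  have h1 := hB.covariance i j
  rw [covariance_eq_sub (hL i) (hL j), hB.centered, zero_mul, sub_zero] at h1
  rw [fBmKernel, abs_of_nonneg i.2.1, abs_of_nonneg j.2.1, ← h1, ← integral_const_mul]
  congr 1
  ext e
  simp only [Pi.mul_apply]
  ring

theorem IsFBm.hasShifts {H ν : ℝ} (hs₀ : 0 < s₀) {P : Measure (PosPath 0 T s₀)}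
    {B : Set.Icc (0 : ℝ) T → E → ℝ} (hB : IsFBm H B Q) (hH : 0 < H) (hH1 : H < 1) (hν : 0 < ν)
    (m : Set.Icc (0 : ℝ) T → ℝ)
    (hP : IsPathLaw (fun t e => s₀ * Real.exp (m t + ν * B t e)) Q P) : HasShifts P := by
  have := hB.gaussian.isProbabilityMeasure
  refine hasShifts_of_kernel_le hs₀ (hB.gaussian.smul fun _ => ν) (fun t => ?_) m hP hH hH1
    (pow_pos hν 2) fun F c => ?_
  · simp [integral_const_mul, hB.centered]
  · rw [← hB.integral_sum_sq, ← integral_const_mul]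
    refine (integral_congr_ae (Eventually.of_forall fun e => ?_)).le
    simp only [smul_eq_mul]
    rw [← mul_pow, Finset.mul_sum]
    congr 1
    exact Finset.sum_congr rfl fun i _ => by ring

/-- By independence the cross term vanishes and the fractional part contributes a non-negative
quadratic form, so the Brownian kernel, with `κ = σ²`, is a lower bound. -/
theorem hasShifts_of_mixed {H σ ν : ℝ} (hs₀ : 0 < s₀) {P : Measure (PosPath 0 T s₀)}
    {W B : Set.Icc (0 : ℝ) T → E → ℝ} (hW : IsBm W Q) (hB : IsFBm H B Q)
    (hWB : IndepFun (fun e t => W t e) (fun e t => B t e) Q) (hσ : 0 < σ)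
    (m : Set.Icc (0 : ℝ) T → ℝ)
    (hP : IsPathLaw (fun t e => s₀ * Real.exp (m t + (σ * W t e + ν * B t e))) Q P) :
    HasShifts P := by
  have := hB.gaussian.isProbabilityMeasure
  have hWL : ∀ t, MemLp (W t) 2 Q := fun t => (hW.gaussian.hasGaussianLaw_eval t).memLp_two
  have hBL : ∀ t, MemLp (B t) 2 Q := fun t => (hB.gaussian.hasGaussianLaw_eval t).memLp_two
  have hWI : ∀ t, Integrable (W t) Q := fun t => (hWL t).integrable (by norm_num)
  have hBI : ∀ t, Integrable (B t) Q := fun t => (hBL t).integrable (by norm_num)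
  have hZ : IsGaussianProcess (fun t e => σ * W t e + ν * B t e) Q := by
    refine ⟨fun F => ?_⟩
    have hind : IndepFun (fun e => F.restrict fun t => W t e) (fun e => F.restrict fun t => B t e) Q :=
      hWB.comp (φ := F.restrict) (ψ := F.restrict) (by fun_prop) (by fun_prop)
    have h1 := (hind.hasGaussianLaw (hW.gaussian.hasGaussianLaw F) (hB.gaussian.hasGaussianLaw F)).map_fun
      (σ • ContinuousLinearMap.fst ℝ (F → ℝ) (F → ℝ) + ν • ContinuousLinearMap.snd ℝ (F → ℝ) (F → ℝ))
    exact h1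
  refine hasShifts_of_kernel_le hs₀ hZ (fun t => ?_) m hP (H := 1 / 2) (by norm_num) (by norm_num)
    (pow_pos hσ 2) fun F c => ?_
  · rw [integral_add ((hWI t).const_mul _) ((hBI t).const_mul _), integral_const_mul,
      integral_const_mul, hW.centered, hB.centered]
    simp
  set w : E → ℝ := fun e => ∑ i ∈ F, c i * W i e
  set b : E → ℝ := fun e => ∑ i ∈ F, c i * B i e
  have hw : MemLp w 2 Q := memLp_finsetSum _ fun i _ => (hWL i).const_mul _
  have hb : MemLp b 2 Q := memLp_finsetSum _ fun i _ => (hBL i).const_mul _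
  have hwb : ∫ e, w e * b e ∂Q = 0 := by
    have hφ : Measurable fun x : Set.Icc (0 : ℝ) T → ℝ => ∑ i ∈ F, c i * x i := by fun_prop
    have hind : IndepFun w b Q := hWB.comp hφ hφ
    have h1 := hind.integral_fun_mul_eq_mul_integral hw.aestronglyMeasurable hb.aestronglyMeasurable
    have h2 : ∫ e, w e ∂Q = 0 := by
      rw [integral_finsetSum _ fun i _ => (hWI i).const_mul _]
      simp [integral_const_mul, hW.centered]
    rw [h1, h2, zero_mul]
  have hsq : ∀ e, (∑ i ∈ F, c i * (σ * W i e + ν * B i e)) ^ 2 =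
      σ ^ 2 * w e ^ 2 + 2 * σ * ν * (w e * b e) + ν ^ 2 * b e ^ 2 := fun e => by
    have : ∑ i ∈ F, c i * (σ * W i e + ν * B i e) = σ * w e + ν * b e := by
      simp only [w, b, Finset.mul_sum, ← Finset.sum_add_distrib]
      exact Finset.sum_congr rfl fun i _ => by ring
    rw [this]
    ring
  have h1 := hw.integrable_sq.const_mul (σ ^ 2)
  have h2 : Integrable (fun e => 2 * σ * ν * (w e * b e)) Q :=
    (hw.integrable_mul hb).const_mul (2 * σ * ν)
  have h3 := hb.integrable_sq.const_mul (ν ^ 2)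
  have h12 : Integrable (fun e => σ ^ 2 * w e ^ 2 + 2 * σ * ν * (w e * b e)) Q := h1.add h2
  simp_rw [hsq]
  rw [integral_add h12 h3, integral_add h1 h2, integral_const_mul, integral_const_mul,
    integral_const_mul]
  have h5 : ∫ e, w e ^ 2 ∂Q = _ := hW.integral_sum_sq F c
  rw [h5, hwb]
  have : 0 ≤ ν ^ 2 * ∫ e, b e ^ 2 ∂Q :=
    mul_nonneg (sq_nonneg _) (integral_nonneg fun e => sq_nonneg _)
  linarith

end ModelLaws

/-! ### Measurability as invariance off a null set -/

section Determined

variable {Ω : Type*} [MeasurableSpace Ω]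

/-- The σ-algebra of the sets which, up to a null set, are invariant under a relation. -/
@[reducible] def determinedSigma (P : Measure Ω) (R : Ω → Ω → Prop) : MeasurableSpace Ω where
  MeasurableSet' s := ∃ N, P N = 0 ∧ ∀ ω ω', ω ∉ N → ω' ∉ N → R ω ω' → (ω ∈ s ↔ ω' ∈ s)
  measurableSet_empty := ⟨∅, measure_empty, by simp⟩
  measurableSet_compl := by
    rintro s ⟨N, hN, h⟩
    exact ⟨N, hN, fun ω ω' h1 h2 h3 => not_congr (h ω ω' h1 h2 h3)⟩
  measurableSet_iUnion s hs := by
    choose N hN h using hs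
    refine ⟨⋃ i, N i, measure_iUnion_null hN, fun ω ω' h1 h2 h3 => ?_⟩
    simp only [mem_iUnion, not_exists] at h1 h2 ⊢
    exact exists_congr fun i => h i ω ω' (h1 i) (h2 i) h3

variable {P : Measure Ω} {R : Ω → Ω → Prop}

theorem exists_null_eq_of_measurable {f : Ω → ℝ} (hf : Measurable[determinedSigma P R] f) :
    ∃ N, P N = 0 ∧ ∀ ω ω', ω ∉ N → ω' ∉ N → R ω ω' → f ω = f ω' := by
  have h1 : ∀ q : ℚ, MeasurableSet[determinedSigma P R] (f ⁻¹' Set.Iic (q : ℝ)) := fun q =>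
    hf measurableSet_Iic
  choose N hN h using h1
  refine ⟨⋃ q, N q, measure_iUnion_null hN, fun ω ω' h1 h2 h3 => ?_⟩
  simp only [mem_iUnion, not_exists] at h1 h2
  have h4 : ∀ q : ℚ, f ω ≤ q ↔ f ω' ≤ q := fun q => h q ω ω' (h1 q) (h2 q) h3
  refine le_antisymm (le_of_not_gt fun h5 => ?_) (le_of_not_gt fun h5 => ?_)
  · obtain ⟨q, hq, hq'⟩ := exists_rat_btwn h5
    exact absurd ((h4 q).2 hq.le) (not_le.2 hq')
  · obtain ⟨q, hq, hq'⟩ := exists_rat_btwn h5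
    exact absurd ((h4 q).1 hq.le) (not_le.2 hq')

/-- A single null set of first co-ordinates serves all `η`: the sets with this property form a
σ-algebra containing both kinds of generating cylinders. -/
theorem exists_null_section_of_measurableSet {β : Type*} [mβ : MeasurableSpace β] {Γ : Set (Ω × β)}
    (hΓ : MeasurableSet[(determinedSigma P R).prod mβ] Γ) :
    ∃ N, P N = 0 ∧ ∀ ω ω', ω ∉ N → ω' ∉ N → R ω ω' → ∀ η, (ω, η) ∈ Γ ↔ (ω', η) ∈ Γ := by
  let m : MeasurableSpace (Ω × β) :=
    { MeasurableSet' := fun Γ => ∃ N, P N = 0 ∧ ∀ ω ω', ω ∉ N → ω' ∉ N → R ω ω' →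
        ∀ η, (ω, η) ∈ Γ ↔ (ω', η) ∈ Γ
      measurableSet_empty := ⟨∅, measure_empty, by simp⟩
      measurableSet_compl := by
        rintro s ⟨N, hN, h⟩
        exact ⟨N, hN, fun ω ω' h1 h2 h3 η => not_congr (h ω ω' h1 h2 h3 η)⟩
      measurableSet_iUnion := fun s hs => by
        choose N hN h using hs
        refine ⟨⋃ i, N i, measure_iUnion_null hN, fun ω ω' h1 h2 h3 η => ?_⟩
        simp only [mem_iUnion, not_exists] at h1 h2 ⊢
        exact exists_congr fun i => h i ω ω' (h1 i) (h2 i) h3 η }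
  have hle : (determinedSigma P R).prod mβ ≤ m := by
    refine sup_le ?_ ?_
    · rintro _ ⟨s, ⟨N, hN, h⟩, rfl⟩
      exact ⟨N, hN, fun ω ω' h1 h2 h3 η => h ω ω' h1 h2 h3⟩
    · rintro _ ⟨s, -, rfl⟩
      exact ⟨∅, measure_empty, fun ω ω' _ _ _ η => Iff.rfl⟩
  exact hle Γ hΓ

end Determined

/-! ### Information at a stopping time as dependence on the past -/

section Stopping

variable {T s₀ : ℝ} {P : Measure (PosPath 0 T s₀)}

theorem completedFiltration_le_determinedSigma (q : Set.Icc (0 : ℝ) T) :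
    completedFiltration P q ≤ determinedSigma P fun ω ω' => ∀ t ≤ q, ω t = ω' t := by
  refine sup_le (iSup₂_le fun s hs => ?_) (MeasurableSpace.generateFrom_le fun N hN => ?_)
  · rintro _ ⟨A, -, rfl⟩
    refine ⟨∅, measure_empty, fun ω ω' _ _ h => ?_⟩
    rw [mem_preimage, mem_preimage, h s hs]
  -- A null set is its own exceptional set.
  · exact ⟨N, hN, fun ω ω' h1 h2 _ => iff_of_false h1 h2⟩

theorem usualFiltration_le_completedFiltration {p q : Set.Icc (0 : ℝ) T} (hpq : p < q) :
    usualFiltration P p ≤ completedFiltration P q := by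
  rw [usualFiltration, Filtration.rightCont_eq_of_not_isMax _ (not_isMax_iff.2 ⟨q, hpq⟩)]
  exact iInf₂_le q hpq

variable {n : ℕ} (τ : StoppingSeq P n)

/-- Two paths agree up to some time after `τₖ`. -/
def StoppingSeq.Agree (k : Fin (n + 1)) (ω ω' : PosPath 0 T s₀) : Prop :=
  ∃ q, τ.time k ω < q ∧ ∀ t ≤ q, ω t = ω' t

theorem StoppingSeq.Agree.mono {τ : StoppingSeq P n} {j k : Fin (n + 1)} (hjk : j ≤ k)
    {ω ω' : PosPath 0 T s₀} (h : τ.Agree k ω ω') : τ.Agree j ω ω' :=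
  let ⟨q, h1, h2⟩ := h
  ⟨q, (τ.monotone ω hjk).trans_lt h1, h2⟩

/-- Between `τₖ` and the time of agreement lie `i < j` from a countable dense set. Right-continuity
costs only the passage from `i` to `j`: the trace of the event on `{τₖ ≤ i}` is determined by the
path up to `j`, and countably many null sets suffice. -/
theorem StoppingSeq.sigma_le_determinedSigma (k : Fin (n + 1)) :
    τ.sigma k ≤ determinedSigma P (τ.Agree k) := by
  intro s hs
  obtain ⟨D, hDc, hDd⟩ := TopologicalSpace.exists_countable_dense (Set.Icc (0 : ℝ) T)
  have h1 : ∀ i j : Set.Icc (0 : ℝ) T, ∃ N, P N = 0 ∧ (i < j → ∀ ω ω', ω ∉ N → ω' ∉ N →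
      (∀ t ≤ j, ω t = ω' t) → (τ.time k ω ≤ i ↔ τ.time k ω' ≤ i) ∧
        (ω ∈ s ∧ τ.time k ω ≤ i ↔ ω' ∈ s ∧ τ.time k ω' ≤ i)) := by
    intro i j
    by_cases hij : i < j
    · have hle := (usualFiltration_le_completedFiltration (P := P) hij).trans
        (completedFiltration_le_determinedSigma j)
      obtain ⟨N₁, hN₁, h₁⟩ := hle _ (τ.isStoppingTime k i)
      obtain ⟨N₂, hN₂, h₂⟩ := hle _ (hs.2 i)
      refine ⟨N₁ ∪ N₂, measure_union_null hN₁ hN₂, fun _ ω ω' hω hω' h => ⟨?_, ?_⟩⟩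
      · have := h₁ ω ω' (fun h => hω (.inl h)) (fun h => hω' (.inl h)) h
        simpa using this
      · have := h₂ ω ω' (fun h => hω (.inr h)) (fun h => hω' (.inr h)) h
        simpa using this
    · exact ⟨∅, measure_empty, fun h => absurd h hij⟩
  choose N hN h using h1
  refine ⟨⋃ i ∈ D, ⋃ j ∈ D, N i j, (measure_biUnion_null_iff hDc).2 fun i _ =>
    (measure_biUnion_null_iff hDc).2 fun j _ => hN i j, fun ω ω' hω hω' hR => ?_⟩
  obtain ⟨q, hq, hωω'⟩ := hR
  obtain ⟨i, hi, hτi, hiq⟩ := hDd.exists_between hq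
  obtain ⟨j, hj, hij, hjq⟩ := hDd.exists_between hiq
  simp only [mem_iUnion, not_exists] at hω hω'
  obtain ⟨h1, h2⟩ := h i j hij ω ω' (hω i hi j hj) (hω' i hi j hj)
    fun t ht => hωω' t (ht.trans hjq.le)
  have h3 : τ.time k ω ≤ i := hτi.le
  exact ⟨fun h4 => (h2.1 ⟨h4, h3⟩).1, fun h4 => (h2.2 ⟨h4, h1.1 h3⟩).1⟩

theorem StoppingSeq.measurable_time (k : Fin (n + 1)) :
    Measurable[τ.sigma k] fun ω => (τ.time k ω : ℝ) := by
  refine @measurable_of_Iic ℝ _ _ _ _ (τ.sigma k) _ _ _ _ fun x => ?_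
  by_cases hx : x ∈ Set.Icc (0 : ℝ) T
  · have h1 := (τ.isStoppingTime k).measurableSet_le' ⟨x, hx⟩
    convert h1 using 1
    ext ω
    simp [← Subtype.coe_le_coe]
  · rcases lt_or_ge x 0 with h0 | h0
    · convert @MeasurableSet.empty _ (τ.sigma k)
      ext ω
      simpa using h0.trans_le (τ.time k ω).2.1
    · convert @MeasurableSet.univ _ (τ.sigma k)
      ext ω
      simpa using (τ.time k ω).2.2.trans (le_of_not_ge fun h => hx ⟨h0, h⟩)

theorem StoppingSeq.exists_null_eq {k : Fin (n + 1)} {f : PosPath 0 T s₀ → ℝ}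
    (hf : Measurable[τ.sigma k] f) :
    ∃ N, P N = 0 ∧ ∀ ω ω', ω ∉ N → ω' ∉ N → τ.Agree k ω ω' → f ω = f ω' :=
  exists_null_eq_of_measurable (hf.mono (τ.sigma_le_determinedSigma k) le_rfl)

theorem StoppingSeq.exists_null_time_eq (k : Fin (n + 1)) :
    ∃ N, P N = 0 ∧ ∀ ω ω', ω ∉ N → ω' ∉ N → τ.Agree k ω ω' → τ.time k ω = τ.time k ω' :=
  let ⟨N, hN, h⟩ := τ.exists_null_eq (τ.measurable_time k)
  ⟨N, hN, fun ω ω' h1 h2 h3 => Subtype.ext (h ω ω' h1 h2 h3)⟩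

end Stopping

/-! ### Steering a path against a position -/

section Steering

variable {T s₀ : ℝ} {P : Measure (PosPath 0 T s₀)}

theorem PosPath.continuous_log (ω : PosPath 0 T s₀) : Continuous fun t => Real.log (ω t) :=
  ω.1.continuous.log fun t => (ω.2.1 t).ne'

theorem exists_null_of_shifts {𝒢 : Set (NullStart T)} (hc : 𝒢.Countable)
    (h𝒢 : ∀ g ∈ 𝒢, ∀ N : Set (PosPath 0 T s₀), P N = 0 → P {ω | ω.shift g ∈ N} = 0)
    {N : Set (PosPath 0 T s₀)} (hN : P N = 0) :
    ∃ N', P N' = 0 ∧ N ⊆ N' ∧ ∀ ω ∉ N', ∀ g ∈ 𝒢, ω.shift g ∉ N := by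
  refine ⟨N ∪ ⋃ g ∈ 𝒢, {ω | ω.shift g ∈ N}, measure_union_null hN
    ((measure_biUnion_null_iff hc).2 fun g hg => h𝒢 g hg N hN), subset_union_left,
    fun ω hω g hg h => hω (.inr (mem_biUnion hg h))⟩

/-- A path can be shifted, without a change up to time `p`, close to any target on `[b, T]`. -/
theorem exists_shift_near {𝒢 : Set (NullStart T)}
    (h𝒢 : ∀ a b : Set.Icc (0 : ℝ) T, a < b → ∀ f : C(Set.Icc (0 : ℝ) T, ℝ), (∀ t ≤ b, f t = 0) →
      ∀ r > 0, ∃ g ∈ 𝒢, (∀ t ≤ a, g.1 t = 0) ∧ ∀ t, |g.1 t - f t| < r)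
    {p a b : Set.Icc (0 : ℝ) T} (hpa : p < a) (hab : a < b) (ω : PosPath 0 T s₀)
    (m : C(Set.Icc (0 : ℝ) T, ℝ)) {δ : ℝ} (hδ : 0 < δ) :
    ∃ g ∈ 𝒢, (∀ t ≤ p, ω.shift g t = ω t) ∧ ∀ t, ∃ l : ℝ, 0 ≤ l ∧ l ≤ 1 ∧ (b ≤ t → l = 1) ∧
      |Real.log (ω.shift g t) - ((1 - l) * Real.log (ω t) + l * m t)| < δ := by
  have hab' : (0 : ℝ) < b - a := sub_pos.2 hab
  -- A linear ramp from 0 at `a` to 1 at `b`, interpolating between the log-path and the target.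
  let l : Set.Icc (0 : ℝ) T → ℝ := fun t => max 0 (min 1 (((t : ℝ) - a) / (b - a)))
  have hl : Continuous l := by fun_prop
  have hω := ω.continuous_log
  let f : C(Set.Icc (0 : ℝ) T, ℝ) :=
    ⟨fun t => l t * (m t - Real.log (ω t)), hl.mul (m.continuous.sub hω)⟩
  obtain ⟨g, hg, hgp, hgf⟩ := h𝒢 p a hpa f (fun t ht => by
    have : l t = 0 := max_eq_left ((min_le_right _ _).trans
      (div_nonpos_of_nonpos_of_nonneg (sub_nonpos.2 ht) hab'.le))
    simp [f, this]) δ hδ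
  refine ⟨g, hg, fun t ht => ?_, fun t => ⟨l t, le_max_left _ _,
    max_le zero_le_one (min_le_left _ _), fun ht => ?_, ?_⟩⟩
  · rw [PosPath.shift_apply, hgp t ht, Real.exp_zero, mul_one]
  · have h1 : (1 : ℝ) ≤ ((t : ℝ) - a) / (b - a) := by
      rw [le_div_iff₀ hab', one_mul]
      exact sub_le_sub_right (Subtype.coe_le_coe.2 ht) _
    simp only [l]
    rw [min_eq_left h1, max_eq_right zero_le_one]
  · have h1 := hgf t
    rw [PosPath.log_shift]
    convert h1 using 2
    simp only [f, ContinuousMap.coe_mk]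
    ring

/-- An open set of positive paths contains a ball on the logarithmic scale. -/
theorem PosPath.exists_log_ball {a b x : ℝ} {U : Set (PosPath a b x)} (hU : IsOpen U)
    {u : PosPath a b x} (hu : u ∈ U) :
    ∃ ρ > 0, ∀ v : PosPath a b x, (∀ t, |Real.log (v t) - Real.log (u t)| < ρ) → v ∈ U := by
  obtain ⟨r, hr, hball⟩ := Metric.isOpen_iff.1 hU u hu
  obtain ⟨M, hM⟩ : ∃ M, ∀ t, u t ≤ M := by
    obtain ⟨M, hM⟩ := (isCompact_range u.1.continuous).bddAbove
    exact ⟨M, fun t => hM ⟨t, rfl⟩⟩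
  set M' := max M 1
  have hM' : 0 < M' := lt_max_of_lt_right one_pos
  have hexp : Tendsto (fun x : ℝ => Real.exp x) (𝓝 0) (𝓝 1) := by
    simpa using Real.continuous_exp.tendsto 0
  obtain ⟨ρ, hρ, h⟩ := Metric.tendsto_nhds_nhds.1 hexp (r / 2 / M') (by positivity)
  refine ⟨ρ, hρ, fun v hv => hball ?_⟩
  change dist v.1 u.1 < r
  refine lt_of_le_of_lt ((ContinuousMap.dist_le (half_pos hr).le).2 fun t => ?_) (half_lt_self hr)
  have h1 := h (x := Real.log (v t) - Real.log (u t)) (by simpa using hv t)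
  have h2 : v t = u t * Real.exp (Real.log (v t) - Real.log (u t)) := by
    rw [Real.exp_sub, Real.exp_log (v.2.1 t), Real.exp_log (u.2.1 t),
      mul_div_cancel₀ _ (u.2.1 t).ne']
  rw [Real.dist_eq] at h1
  have h3 : v t - u t = u t * (Real.exp (Real.log (v t) - Real.log (u t)) - 1) := by
    rw [mul_sub, ← h2, mul_one]
  change dist (v t) (u t) ≤ r / 2
  rw [Real.dist_eq, h3, abs_mul, abs_of_pos (u.2.1 t)]
  calc u t * |Real.exp (Real.log (v t) - Real.log (u t)) - 1|
      ≤ M' * (r / 2 / M') :=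
        mul_le_mul ((hM t).trans (le_max_left _ _)) h1.le (abs_nonneg _) hM'.le
    _ = r / 2 := mul_div_cancel₀ _ hM'.ne'

variable {n : ℕ} {τ : StoppingSeq P n}

/-- Up to null sets, every path for which `τₖ < τₖ₊₁` agrees up to some time after `τₖ` with a path
whose increment over `[τₖ, τₖ₊₁]` has a prescribed sign. -/
theorem StoppingSeq.HasDelay.exists_adverse_path (hτ : τ.HasDelay) (hP : HasShifts P) (k : Fin n)
    {N : Set (PosPath 0 T s₀)} (hN : P N = 0) :
    ∃ N', P N' = 0 ∧ N ⊆ N' ∧ ∀ ω ∉ N', τ.time k.castSucc ω < τ.time k.succ ω → ∀ c : ℝ, c ≠ 0 →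
      ∃ ω' ∉ N, τ.Agree k.castSucc ω ω' ∧
        0 < c * (ω' (τ.time k.succ ω') - ω' (τ.time k.castSucc ω')) := by
  obtain ⟨𝒢, h𝒢c, h𝒢N, h𝒢d⟩ := hP
  obtain ⟨U, ε, hUo, hUne, hUm, hεm, hε0, hdelay⟩ := hτ k
  obtain ⟨N₁, hN₁, h₁⟩ := τ.exists_null_time_eq k.castSucc
  obtain ⟨N₂, hN₂, h₂⟩ := τ.exists_null_time_eq k.succ
  obtain ⟨N₃, hN₃, h₃⟩ := τ.exists_null_eq hεm
  obtain ⟨N₄, hN₄, h₄⟩ := exists_null_section_of_measurableSet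
    (sup_le_sup_right (MeasurableSpace.comap_mono (τ.sigma_le_determinedSigma k.castSucc)) _ _ hUm)
  obtain ⟨N₅, hN₅, h₅⟩ : ∃ N, P N = 0 ∧ ∀ ω ∉ N, (U ω).Nonempty ∧ 0 < ε ω ∧
      (ω.tail (τ.time k.castSucc ω) _ rfl ∈ U ω → τ.time k.castSucc ω < τ.time k.succ ω →
        ε ω ≤ (τ.time k.succ ω : ℝ) - (τ.time k.castSucc ω : ℝ)) :=
    ⟨_, hUne.and (hε0.and hdelay), fun ω hω => not_not.1 hω⟩
  set M := N ∪ (N₁ ∪ (N₂ ∪ (N₃ ∪ (N₄ ∪ N₅))))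
  have hM : P M = 0 := measure_union_null hN (measure_union_null hN₁ (measure_union_null hN₂
    (measure_union_null hN₃ (measure_union_null hN₄ hN₅))))
  -- Two shifts will be applied in succession, so the null set is enlarged twice.
  obtain ⟨M₁, hM₁, hMM₁, hM₁g⟩ := exists_null_of_shifts h𝒢c h𝒢N hM
  obtain ⟨M₂, hM₂, hMM₂, hM₂g⟩ := exists_null_of_shifts h𝒢c h𝒢N hM₁
  refine ⟨M₂, hM₂, (subset_union_left.trans hMM₁).trans hMM₂, fun ω hω hlt c hc => ?_⟩
  have hωM : ω ∉ M := fun h => hω (hMM₂ (hMM₁ h))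
  have hnot : ∀ ω ∉ M, ω ∉ N ∧ ω ∉ N₁ ∧ ω ∉ N₂ ∧ ω ∉ N₃ ∧ ω ∉ N₄ ∧ ω ∉ N₅ := fun ω hω => by
    simpa only [M, mem_union, not_or] using hω
  obtain ⟨hω0, hω1, hω2, hω3, hω4, hω5⟩ := hnot ω hωM
  set t₀ := τ.time k.castSucc ω
  obtain ⟨⟨u, hu⟩, hεω, -⟩ := h₅ ω hω5
  obtain ⟨ρ, hρ, hρU⟩ := PosPath.exists_log_ball (hUo ω) hu
  set ℓ := Real.log (ω t₀) with hℓ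
  let e : Set.Icc (0 : ℝ) T → Set.Icc (t₀ : ℝ) T := fun t =>
    ⟨max t t₀, le_max_right _ _, max_le t.2.2 t₀.2.2⟩
  have he : Continuous e := by fun_prop
  let m : C(Set.Icc (0 : ℝ) T, ℝ) := ⟨fun t => Real.log (u (e t)),
    (u.1.continuous.comp he).log fun t => (u.2.1 (e t)).ne'⟩
  have hm₀ : m t₀ = ℓ := by
    change Real.log (u (e t₀)) = ℓ
    rw [u.2.2 (e t₀) (max_self _)]
  -- Up to `b₂` the first shifted log-path is within `3δ` of `ℓ` and `m` is within `δ` of `ℓ`; the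
  -- second shift has error `δ`. The total is below `6δ`.
  set δ := ρ / 6 with hδdef
  have hδ : 0 < δ := by positivity
  obtain ⟨b₂, hb₂, hb₂s⟩ : ∃ b₂ > t₀, ∀ t, t₀ ≤ t → t ≤ b₂ →
      |Real.log (ω t) - ℓ| < δ ∧ |m t - ℓ| < δ ∧ (t : ℝ) - t₀ < ε ω := by
    have h1 : ∀ᶠ t in 𝓝 t₀, |Real.log (ω t) - ℓ| < δ ∧ |m t - ℓ| < δ ∧ (t : ℝ) - t₀ < ε ω := by
      refine ((ω.continuous_log.sub continuous_const).abs.tendsto t₀ |>.eventually_lt_const ?_).and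
        (((m.continuous.sub continuous_const).abs.tendsto t₀ |>.eventually_lt_const ?_).and
        ((continuous_subtype_val.sub continuous_const).tendsto t₀ |>.eventually_lt_const ?_))
      · change |Real.log (ω t₀) - ℓ| < δ
        rwa [← hℓ, sub_self, abs_zero]
      · change |m t₀ - ℓ| < δ
        rwa [hm₀, sub_self, abs_zero]
      · simpa using hεω
    obtain ⟨b₃, hb₃, h2⟩ :=
      (mem_nhdsGE_iff_exists_Ico_subset' hlt).1 (mem_nhdsWithin_of_mem_nhds h1)
    obtain ⟨b₂, hb₂, hb₂₃⟩ := exists_between (mem_Ioi.1 hb₃)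
    exact ⟨b₂, hb₂, fun t h3 h4 => h2 ⟨h3, h4.trans_lt hb₂₃⟩⟩
  obtain ⟨b, hb, hbb₂⟩ := exists_between hb₂
  obtain ⟨a₂, ha₂, ha₂b₂⟩ := exists_between hbb₂
  obtain ⟨a, ha, hab⟩ := exists_between hb
  obtain ⟨p, hp, hpa⟩ := exists_between ha
  obtain ⟨s, hs, hsc⟩ : ∃ s : ℝ, (s = 1 ∨ s = -1) ∧ 0 < c * s := by
    rcases lt_or_gt_of_ne hc with h | h
    · exact ⟨-1, .inr rfl, by linarith⟩
    · exact ⟨1, .inl rfl, by linarith⟩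
  -- The times satisfy `t₀ < p < a < b < a₂ < b₂`. From `b` on, the log-price is within `δ` of `ℓ +
  -- 2sδ`, hence on the side of `ℓ` given by `s`.
  obtain ⟨g₁, hg₁, hg₁p, hg₁m⟩ := exists_shift_near h𝒢d hpa hab ω
    (ContinuousMap.const _ (ℓ + 2 * s * δ)) hδ
  set ω₁ := ω.shift g₁
  have hω₁M₁ : ω₁ ∉ M₁ := hM₂g ω hω g₁ hg₁
  obtain ⟨hω₁0, hω₁1, hω₁2, hω₁3, hω₁4, hω₁5⟩ := hnot ω₁ fun h => hω₁M₁ (hMM₁ h)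
  have hA₁ : τ.Agree k.castSucc ω ω₁ := ⟨p, hp, fun t ht => (hg₁p t ht).symm⟩
  have ht₁ : τ.time k.castSucc ω₁ = t₀ := (h₁ ω ω₁ hω1 hω₁1 hA₁).symm
  -- If the next trade on `ω₁` took place at `t₀`, agreement up to `p` would put it at `t₀` on `ω`
  -- too.
  have hlt₁ : t₀ < τ.time k.succ ω₁ := by
    refine lt_of_le_of_ne (ht₁ ▸ τ.monotone ω₁ k.castSucc_lt_succ.le) fun h => ?_
    have := h₂ ω₁ ω hω₁2 hω2 ⟨p, h ▸ hp, hg₁p⟩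
    exact hlt.ne (h.trans this)
  have hωt₀ : ω₁ t₀ = ω t₀ := hg₁p t₀ hp.le
  rcases le_or_gt b (τ.time k.succ ω₁) with hcase | hcase
  · refine ⟨ω₁, hω₁0, hA₁, ?_⟩
    obtain ⟨l, -, -, hl1, hl⟩ := hg₁m (τ.time k.succ ω₁)
    rw [hl1 hcase] at hl
    simp only [ContinuousMap.const_apply, sub_self, zero_mul, zero_add, one_mul] at hl
    rw [ht₁, hωt₀]
    have hpos := ω.2.1 t₀
    have hpos₁ := ω₁.2.1 (τ.time k.succ ω₁)
    rw [abs_lt] at hl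
    rcases hs with rfl | rfl
    · have := (Real.log_lt_log_iff hpos hpos₁).1 (by linarith)
      exact mul_pos (by linarith) (sub_pos.2 this)
    · have := (Real.log_lt_log_iff hpos₁ hpos).1 (by linarith)
      exact mul_pos_of_neg_of_neg (by linarith) (sub_neg.2 this)
  · exfalso
    -- The trade precedes `b`, so a change after `b` cannot affect it. The path is now led near `u`,
    -- hence into `U`, and the delay is violated because `b - t₀ < ε ω`.
    obtain ⟨g₂, hg₂, hg₂p, hg₂m⟩ := exists_shift_near h𝒢d ha₂ ha₂b₂ ω₁ m hδ
    set ω₂ := ω₁.shift g₂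
    obtain ⟨hω₂0, hω₂1, hω₂2, hω₂3, hω₂4, hω₂5⟩ := hnot ω₂ (hM₁g ω₁ hω₁M₁ g₂ hg₂)
    have hA₂ : τ.Agree k.castSucc ω ω₂ := ⟨p, hp, fun t ht =>
      (hg₁p t ht).symm.trans (hg₂p t (ht.trans (hpa.trans hab).le)).symm⟩
    have ht₂ : τ.time k.castSucc ω₂ = t₀ := (h₁ ω ω₂ hω1 hω₂1 hA₂).symm
    have ht₂' : τ.time k.succ ω₂ = τ.time k.succ ω₁ :=
      (h₂ ω₁ ω₂ hω₁2 hω₂2 ⟨b, hcase, fun t ht => (hg₂p t ht).symm⟩).symm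
    have hεω₂ : ε ω₂ = ε ω := (h₃ ω ω₂ hω3 hω₂3 hA₂).symm
    have hωt₂ : ω₂ t₀ = ω t₀ := (hg₂p t₀ hb.le).trans hωt₀
    have hmem : (ω, ω₂) ∈ {p : PosPath 0 T s₀ × PosPath 0 T s₀ |
        ∃ h : p.2 (τ.time k.castSucc p.1) = p.1 (τ.time k.castSucc p.1),
          p.2.tail (τ.time k.castSucc p.1) _ h ∈ U p.1} := by
      refine ⟨hωt₂, hρU _ fun t => ?_⟩
      let t' : Set.Icc (0 : ℝ) T := ⟨t, t₀.2.1.trans t.2.1, t.2.2⟩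
      have htt' : t₀ ≤ t' := t.2.1
      have hmt : m t' = Real.log (u t) := by
        have : e t' = t := Subtype.ext (max_eq_left t.2.1)
        change Real.log (u (e t')) = _
        rw [this]
      change |Real.log (ω₂ t') - Real.log (u t)| < ρ
      rw [← hmt]
      obtain ⟨l, hl0, hl1, hlb, hl⟩ := hg₂m t'
      rcases le_total b₂ t' with hbt | hbt
      · rw [hlb hbt] at hl
        rw [abs_lt] at hl ⊢
        constructor <;> linarith [hl.1, hl.2]
      · obtain ⟨h1, h2, -⟩ := hb₂s t' htt' hbt
        obtain ⟨l', hl0', hl1', -, hl'⟩ := hg₁m t'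
        simp only [ContinuousMap.const_apply] at hl'
        have h3 : |Real.log (ω₁ t') - ℓ| ≤ 3 * δ := by
          rw [abs_lt] at h1 hl'
          rw [abs_le]
          rcases hs with rfl | rfl <;> constructor <;> nlinarith [hl'.1, hl'.2, h1.1, h1.2]
        rw [abs_lt] at h2 hl ⊢
        rw [abs_le] at h3
        constructor <;> nlinarith [hl.1, hl.2, h3.1, h3.2, h2.1, h2.2]
    -- Membership is established for the random set at `ω`, but the delay concerns the one at `ω₂`;
    -- the two have the same section since the paths agree past `τₖ`.
    have hmem₂ := (h₄ ω ω₂ hω4 hω₂4 hA₂ ω₂).1 hmem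
    obtain ⟨h, hmem₂⟩ := hmem₂
    have hd := (h₅ ω₂ hω₂5).2.2 hmem₂ (by rw [ht₂, ht₂']; exact hlt₁)
    rw [hεω₂, ht₂, ht₂'] at hd
    have h6 := (hb₂s b hb.le hbb₂.le).2.2
    have h7 : ((τ.time k.succ ω₁ : Set.Icc (0 : ℝ) T) : ℝ) < b := hcase
    linarith

end Steering

/-! ### Induction over the trading times -/

section NoArbitrage

variable {T s₀ : ℝ} {P : Measure (PosPath 0 T s₀)} {n : ℕ} {τ : StoppingSeq P n}
  {hT : 0 < T} {Φ : Portfolio P}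

theorem StoppingSeq.sum_indicator_eq (τ : StoppingSeq P n) (φ : Fin n → ℝ) (ω : PosPath 0 T s₀)
    {k : Fin n} {t : Set.Icc (0 : ℝ) T} (h1 : τ.time k.castSucc ω < t) (h2 : t ≤ τ.time k.succ ω) :
    ∑ j : Fin n, (Set.Ioc (τ.time j.castSucc ω) (τ.time j.succ ω)).indicator (fun _ => φ j) t =
      φ k := by
  rw [Finset.sum_eq_single k]
  · exact indicator_of_mem (mem_Ioc.2 ⟨h1, h2⟩) _
  · intro j _ hjk
    refine indicator_of_notMem (fun h => ?_) _
    rcases lt_or_gt_of_ne hjk with h3 | h3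
    · have := τ.monotone ω (show j.succ ≤ k.castSucc from Fin.succ_le_castSucc_iff.2 h3)
      exact absurd (h.2.trans this) (not_le.2 h1)
    · have := τ.monotone ω (show k.succ ≤ j.castSucc from Fin.succ_le_castSucc_iff.2 h3)
      exact absurd (h2.trans this) (not_le.2 h.1)
  · simp

theorem StoppingSeq.sum_indicator_eq_zero_of_le (τ : StoppingSeq P n) (φ : Fin n → ℝ)
    (ω : PosPath 0 T s₀) {t : Set.Icc (0 : ℝ) T} (h : t ≤ τ.time 0 ω) :
    ∑ j : Fin n, (Set.Ioc (τ.time j.castSucc ω) (τ.time j.succ ω)).indicator (fun _ => φ j) t =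
      0 :=
  Finset.sum_eq_zero fun _ _ => indicator_of_notMem
    (fun h1 => absurd (h.trans (τ.monotone ω (Fin.zero_le _))) (not_le.2 h1.1)) _

theorem StoppingSeq.sum_indicator_eq_zero_of_lt (τ : StoppingSeq P n) (φ : Fin n → ℝ)
    (ω : PosPath 0 T s₀) {t : Set.Icc (0 : ℝ) T} (h : τ.time (Fin.last n) ω < t) :
    ∑ j : Fin n, (Set.Ioc (τ.time j.castSucc ω) (τ.time j.succ ω)).indicator (fun _ => φ j) t =
      0 :=
  Finset.sum_eq_zero fun _ _ => indicator_of_notMem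
    (fun h1 => absurd (h1.2.trans (τ.monotone ω (Fin.le_last _))) (not_le.2 h)) _

/-- A delay-simple strategy with zero initial and almost surely non-negative terminal value has
zero terminal value. -/
theorem value_endTime_eq_zero (hP : HasShifts P) (hτ : τ.HasDelay) (hs : Φ.IsSimpleAlong hT τ)
    (hf : Φ.IsSelfFinancingAlong hT τ) (h0 : ∀ᵐ ω ∂P, Φ.value (startTime hT) ω = 0)
    (hend : ∀ᵐ ω ∂P, 0 ≤ Φ.value (endTime hT) ω) : ∀ᵐ ω ∂P, Φ.value (endTime hT) ω = 0 := by
  obtain ⟨⟨φ, hφm, hφ⟩, ψ₀, ψ, -, -, hψ⟩ := hs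
  obtain ⟨hf1, hf2⟩ := hf
  set V : Fin (n + 1) → PosPath 0 T s₀ → ℝ := fun k ω => Φ.value (τ.time k ω) ω
  have hV0 : ∀ᵐ ω ∂P, V 0 ω = 0 := by
    have h1 : ∀ ω t, t ≤ τ.time 0 ω → Φ.value t ω = ψ₀ ω := fun ω t ht => by
      rw [Portfolio.value, hφ, hψ, τ.sum_indicator_eq_zero_of_le (fun k => φ k ω) ω ht,
        τ.sum_indicator_eq_zero_of_le (fun k => ψ k.castSucc ω) ω ht,
        indicator_of_mem (show t ∈ Set.Iic (τ.time 0 ω) from ht),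
        indicator_of_notMem fun h : t ∈ Set.Ioi (τ.time (Fin.last n) ω) =>
          absurd (ht.trans (τ.monotone ω (Fin.zero_le _))) (not_le.2 h)]
      ring
    filter_upwards [h0] with ω hω
    rw [h1 ω _ (τ.time 0 ω).2.1] at hω
    exact (h1 ω _ le_rfl).trans hω
  have hVT : ∀ᵐ ω ∂P, Φ.value (endTime hT) ω = V (Fin.last n) ω := by
    filter_upwards [hf2] with ω hω
    rw [← sub_eq_zero, hω]
    rcases eq_or_lt_of_le (show τ.time (Fin.last n) ω ≤ endTime hT from
      (τ.time (Fin.last n) ω).2.2) with h | h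
    · rw [h, sub_self, mul_zero]
    · rw [hφ, τ.sum_indicator_eq_zero_of_lt (fun k => φ k ω) ω h, zero_mul]
  have hV : ∀ k : Fin n, ∀ᵐ ω ∂P, V k.succ ω = V k.castSucc ω +
      φ k ω * (ω (τ.time k.succ ω) - ω (τ.time k.castSucc ω)) := fun k => by
    filter_upwards [hf1 k] with ω hω
    rw [← sub_eq_iff_eq_add', hω]
    -- When the two times coincide, the position at that time may differ from `φ k`, but the price
    -- increment is zero.
    rcases eq_or_lt_of_le (τ.monotone ω k.castSucc_lt_succ.le) with h | h
    · rw [show τ.time k.castSucc ω = τ.time k.succ ω from h, sub_self, mul_zero, mul_zero]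
    · rw [hφ, τ.sum_indicator_eq (fun k => φ k ω) ω h le_rfl]
  -- The value at `τₖ` is a function of the path up to just after `τₖ`, by induction along the
  -- self-financing identity.
  have hdet : ∀ k, ∃ N, P N = 0 ∧
      ∀ ω ω', ω ∉ N → ω' ∉ N → τ.Agree k ω ω' → V k ω = V k ω' := by
    intro k
    induction k using Fin.induction with
    | zero =>
      exact ⟨{ω | ¬ V 0 ω = 0}, hV0, fun ω ω' h1 h2 _ => (not_not.1 h1).trans (not_not.1 h2).symm⟩
    | succ k ih =>
      obtain ⟨N₁, hN₁, h₁⟩ := ih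
      obtain ⟨N₂, hN₂, h₂⟩ := τ.exists_null_eq (hφm k)
      obtain ⟨N₃, hN₃, h₃⟩ := τ.exists_null_time_eq k.castSucc
      obtain ⟨N₄, hN₄, h₄⟩ := τ.exists_null_time_eq k.succ
      refine ⟨N₁ ∪ (N₂ ∪ (N₃ ∪ (N₄ ∪ {ω | ¬ (V k.succ ω = V k.castSucc ω +
        φ k ω * (ω (τ.time k.succ ω) - ω (τ.time k.castSucc ω)))}))),
        measure_union_null hN₁ (measure_union_null hN₂ (measure_union_null hN₃
          (measure_union_null hN₄ (hV k)))), fun ω ω' hω hω' hA => ?_⟩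
      simp only [mem_union, not_or, mem_ofPred_eq, not_not] at hω hω'
      have hA' := hA.mono k.castSucc_lt_succ.le
      obtain ⟨q, hq, hqω⟩ := hA
      rw [hω.2.2.2.2, hω'.2.2.2.2, h₁ ω ω' hω.1 hω'.1 hA', h₂ ω ω' hω.2.1 hω'.2.1 hA',
        ← h₃ ω ω' hω.2.2.1 hω'.2.2.1 hA', ← h₄ ω ω' hω.2.2.2.1 hω'.2.2.2.1 ⟨q, hq, hqω⟩,
        hqω _ hq.le, hqω _ ((τ.monotone ω k.castSucc_lt_succ.le).trans hq.le)]
  have hstep : ∀ k : Fin n, (∀ᵐ ω ∂P, 0 ≤ V k.succ ω) →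
      ∀ᵐ ω ∂P, V k.castSucc ω ≤ 0 → V k.succ ω = V k.castSucc ω := by
    intro k hk
    obtain ⟨N₁, hN₁, h₁⟩ := hdet k.castSucc
    obtain ⟨N₂, hN₂, h₂⟩ := τ.exists_null_eq (hφm k)
    have hbad : P (N₁ ∪ (N₂ ∪ {ω | ¬ (0 ≤ V k.succ ω ∧ V k.succ ω = V k.castSucc ω +
        φ k ω * (ω (τ.time k.succ ω) - ω (τ.time k.castSucc ω)))})) = 0 :=
      measure_union_null hN₁ (measure_union_null hN₂ (hk.and (hV k)))
    obtain ⟨N', hN', hNN', hadv⟩ := hτ.exists_adverse_path hP k hbad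
    filter_upwards [compl_mem_ae_iff.2 hN'] with ω hω hneg
    have hω' : ω ∉ N₁ ∪ _ := fun h => hω (hNN' h)
    simp only [mem_union, not_or, mem_ofPred_eq, not_not] at hω' hadv
    rcases eq_or_lt_of_le (τ.monotone ω k.castSucc_lt_succ.le) with h | h
    · rw [hω'.2.2.2, show τ.time k.castSucc ω = τ.time k.succ ω from h, sub_self, mul_zero,
        add_zero]
    by_cases hφ0 : φ k ω = 0
    · rw [hω'.2.2.2, hφ0, zero_mul, add_zero]
    exfalso
    -- On `ω₁` the value and the position at `τₖ` are those of `ω`, while the gain is strictly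
    -- negative, so the value at `τₖ₊₁` would be negative.
    obtain ⟨ω₁, hω₁, hA, hc⟩ := hadv ω hω h (-φ k ω) (neg_ne_zero.2 hφ0)
    have h3 := h₁ ω ω₁ hω'.1 hω₁.1 hA
    have h4 := h₂ ω ω₁ hω'.2.1 hω₁.2.1 hA
    have h5 := hω₁.2.2.1
    rw [hω₁.2.2.2, ← h3, ← h4] at h5
    linarith
  have hnonneg : ∀ k, ∀ᵐ ω ∂P, 0 ≤ V k ω := by
    intro k
    induction k using Fin.reverseInduction with
    | last => filter_upwards [hend, hVT] with ω h1 h2 using h2 ▸ h1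
    | cast k ih =>
      filter_upwards [ih, hstep k ih] with ω h1 h2
      -- A negative value at `τₖ` would persist unchanged to `τₖ₊₁`.
      by_contra h3
      rw [h2 (not_le.1 h3).le] at h1
      exact h3 h1
  have hzero : ∀ k, ∀ᵐ ω ∂P, V k ω = 0 := by
    intro k
    induction k using Fin.induction with
    | zero => exact hV0
    | succ k ih =>
      filter_upwards [ih, hstep k (hnonneg k.succ)] with ω h1 h2
      rw [h2 h1.le, h1]
  filter_upwards [hVT, hzero (Fin.last n)] with ω h1 h2
  rw [h1, h2]

theorem noArbitrageIn_delaySimple (hT : 0 < T) (hP : HasShifts P) :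
    NoArbitrageIn hT (delaySimple hT P) := by
  rintro Φ ⟨n, τ, hτ, hs, hf⟩ ⟨h0, hend, hpos⟩
  have h1 := value_endTime_eq_zero hP hτ hs hf h0 hend
  refine hpos.ne' (measure_mono_null (fun ω hω => ?_) h1)
  exact fun h2 => (ne_of_gt hω) h2

end NoArbitrage

end DelaySimple

end

/-- The Black–Scholes, the fractional Black–Scholes and the mixed fractional Black–Scholes models
are free of arbitrage in the class of delay-simple strategies. -/
theorem mainTheorem1 {E : Type*} [MeasurableSpace E] (Q : Measure E) [IsProbabilityMeasure Q]
    (T s₀ μ : ℝ) (hT : 0 < T) (hs₀ : 0 < s₀)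
    (P : Measure (DelaySimple.PosPath 0 T s₀)) :
    -- the Black–Scholes model
    (∀ (σ : ℝ) (W : Set.Icc (0 : ℝ) T → E → ℝ), 0 < σ → DelaySimple.IsBm W Q →
      DelaySimple.IsPathLaw
        (fun t e => s₀ * Real.exp (μ * t + σ * W t e - σ ^ 2 / 2 * t)) Q P →
      DelaySimple.NoArbitrageIn hT (DelaySimple.delaySimple hT P)) ∧
    -- the fractional Black–Scholes model
    (∀ (ν H : ℝ) (B : Set.Icc (0 : ℝ) T → E → ℝ), 0 < ν → 0 < H → H < 1 → H ≠ 1 / 2 →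
      DelaySimple.IsFBm H B Q →
      DelaySimple.IsPathLaw (fun t e => s₀ * Real.exp (μ * t + ν * B t e)) Q P →
      DelaySimple.NoArbitrageIn hT (DelaySimple.delaySimple hT P)) ∧
    -- the mixed fractional Black–Scholes model
    (∀ (σ ν H : ℝ) (W B : Set.Icc (0 : ℝ) T → E → ℝ), 0 < σ → 0 < ν → 0 < H → H < 1 →
      H ≠ 1 / 2 → DelaySimple.IsBm W Q → DelaySimple.IsFBm H B Q →
      IndepFun (fun e t => W t e) (fun e t => B t e) Q →
      DelaySimple.IsPathLaw
        (fun t e => s₀ * Real.exp (μ * t + σ * W t e - σ ^ 2 / 2 * t + ν * B t e)) Q P →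
      DelaySimple.NoArbitrageIn hT (DelaySimple.delaySimple hT P)) := by
  refine ⟨fun σ W hσ hW hP => ?_, fun ν H B hν hH hH1 _ hB hP => ?_,
    fun σ ν H W B hσ _ _ _ _ hW hB hWB hP => ?_⟩
  · refine DelaySimple.noArbitrageIn_delaySimple hT (hW.hasShifts hs₀ (by norm_num) (by norm_num) hσ
      (fun t => μ * t - σ ^ 2 / 2 * t) ?_)
    convert hP using 5
    ring
  · exact DelaySimple.noArbitrageIn_delaySimple hT (hB.hasShifts hs₀ hH hH1 hν (fun t => μ * t) hP)
  · refine DelaySimple.noArbitrageIn_delaySimple hT (DelaySimple.hasShifts_of_mixed hs₀ hW hB hWB hσ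
      (ν := ν) (fun t => μ * t - σ ^ 2 / 2 * t) ?_)
    convert hP using 5
    ring
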